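/- Let $P\subset\mathbb{R}^2$ be a lattice polygon, i.e. a two-dimensional convex hull of finitely many points of $\mathbb{Z}^2$, and let $\mathcal{T}$ be a unimodular triangulation of $P$, i.e. a triangulation of $P$ whose vertices lie in $\mathbb{Z}^2$ and all of whose triangles have area $1/2$. Let $V=P\cap\mathbb{Z}^2$, $V^o=P^o\cap\mathbb{Z}^2$ and $\partial V=\partial P\cap\mathbb{Z}^2$, where $P^o$ and $\partial P$ are the interior and the boundary of $P$. Let $E$ be the set of edges $\{y,z\}$ of $\mathcal{T}$, let $\partial E$ be the set of those edges whose open segment $(y,z)$ is contained in $\partial P$, and let $E^o=E\setminus\partial E$. For $x\in\mathbb{R}^2$ write $x^2=x\otimes x$, the symmetric $2\times 2$ matrix $(x_ix_j)_{i,j}$, and for bounded $A\subset\mathbb{R}^2$ let $\operatorname{L}^2(A)=\sum_{x\in A\cap\mathbb{Z}^2}x^2$ be the discrete moment matrix. Then, for every integer $n\ge 0$, \begin{align*} \operatorname{L}^2(nP)\ =\ &\frac{n}{12}\sum_{\{y,z\}\in\partial E}(y-z)^2+\frac{n^2}{24}\left(12\sum_{x\in V} x^2+12\sum_{x\in V^o}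 x^2-\sum_{\{y,z\}\in E}(y+z)^2-\sum_{\{y,z\}\in E^o}(y+z)^2\right)\\ &+\frac{n^3}{12}\left(2\sum_{x\in\partial V}x^2+\sum_{\{y,z\}\in\partial E}(y+z)^{2}\right)+\frac{n^4}{24}\left(\sum_{\{y,z\}\in E}(y+z)^2+\sum_{\{y,z\}\in E^o}(y+z)^2\right). \end{align*} -/

import Mathlib

open scoped Pointwise

noncomputable section

namespace LatticePolygon

/-- The integer lattice `ℤ²` inside the plane `ℝ²`. -/
def lattice : Set (Fin 2 → ℝ) :=
  Set.range fun m : Fin 2 → ℤ => fun i => (m i : ℝ)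

/-- A lattice polygon: a two-dimensional convex hull of finitely many lattice points. -/
def IsLatticePolygon (P : Set (Fin 2 → ℝ)) : Prop :=
  (∃ S : Finset (Fin 2 → ℝ), (S : Set (Fin 2 → ℝ)) ⊆ lattice ∧
      P = convexHull ℝ (S : Set (Fin 2 → ℝ))) ∧
    (interior P).Nonempty

/-- The symmetric tensor `x² = x ⊗ x`, as the matrix with entries `x i * x j`. -/
def sq (x : Fin 2 → ℝ) : Matrix (Fin 2) (Fin 2) ℝ :=
  Matrix.vecMulVec x x

/-- The discrete moment matrix `L²(A)`, the sum of `x²` over the lattice points `x` of a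
bounded set `A`. -/
def momentMatrix (A : Set (Fin 2 → ℝ)) : Matrix (Fin 2) (Fin 2) ℝ :=
  ∑ᶠ x ∈ A ∩ lattice, sq x

/-- `T` is a unimodular triangulation of `P`: a simplicial complex that covers exactly `P`, whose
vertices are lattice points and all of whose triangles have the minimal possible area `1/2`. -/
structure IsUnimodularTriangulation (T : Geometry.SimplicialComplex ℝ (Fin 2 → ℝ))
    (P : Set (Fin 2 → ℝ)) : Prop where
  space_eq : T.space = P
  vertices_subset : T.vertices ⊆ lattice
  area_eq : ∀ s ∈ T.faces, s.card = 3 →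
    MeasureTheory.volume (convexHull ℝ (s : Set (Fin 2 → ℝ))) = 1 / 2

/-- The edge graph of a simplicial complex in the plane (points of the plane that are not
vertices of the complex are isolated and do not matter for the edges). -/
def edgeGraph (T : Geometry.SimplicialComplex ℝ (Fin 2 → ℝ)) : SimpleGraph (Fin 2 → ℝ) where
  Adj y z := y ≠ z ∧ {y, z} ∈ T.faces
  symm := ⟨fun y z h => ⟨h.1.symm, by rw [Finset.pair_comm]; exact h.2⟩⟩
  loopless := ⟨fun _ h => h.1 rfl⟩

/-- The open segment `(y, z)` spanned by an unordered pair `{y, z}`. -/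
def openEdge : Sym2 (Fin 2 → ℝ) → Set (Fin 2 → ℝ) :=
  Sym2.lift ⟨fun y z => openSegment ℝ y z, fun y z => openSegment_symm ℝ y z⟩

/-- `(y + z)²` for an unordered pair `{y, z}`. -/
def sumSq : Sym2 (Fin 2 → ℝ) → Matrix (Fin 2) (Fin 2) ℝ :=
  Sym2.lift ⟨fun y z => sq (y + z), fun y z => congrArg sq (add_comm y z)⟩

/-- `(y - z)²` for an unordered pair `{y, z}`. -/
def diffSq : Sym2 (Fin 2 → ℝ) → Matrix (Fin 2) (Fin 2) ℝ :=
  Sym2.lift ⟨fun y z => sq (y - z), fun y z => by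
    change sq (y - z) = sq (z - y)
    rw [← neg_sub z y, sq, sq, Matrix.neg_vecMulVec, Matrix.vecMulVec_neg, neg_neg]⟩

/-- `V`: the lattice points in `P`. -/
def V (P : Set (Fin 2 → ℝ)) : Set (Fin 2 → ℝ) := P ∩ lattice

/-- `V°`: the lattice points in the interior of `P`. -/
def intV (P : Set (Fin 2 → ℝ)) : Set (Fin 2 → ℝ) := interior P ∩ lattice

/-- `∂V`: the lattice points on the boundary of `P`. -/
def bdV (P : Set (Fin 2 → ℝ)) : Set (Fin 2 → ℝ) := frontier P ∩ lattice

/-- `E`: the edges of the triangulation. -/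
def E (T : Geometry.SimplicialComplex ℝ (Fin 2 → ℝ)) : Set (Sym2 (Fin 2 → ℝ)) :=
  (edgeGraph T).edgeSet

/-- `E°`: the edges `{y, z}` whose open segment `(y, z)` is not contained in the boundary
of `P`. -/
def intE (T : Geometry.SimplicialComplex ℝ (Fin 2 → ℝ)) (P : Set (Fin 2 → ℝ)) :
    Set (Sym2 (Fin 2 → ℝ)) :=
  {e ∈ E T | ¬ openEdge e ⊆ frontier P}

/-- `∂E`: the edges `{y, z}` whose open segment `(y, z)` is contained in the boundary of `P`. -/
def bdE (T : Geometry.SimplicialComplex ℝ (Fin 2 → ℝ)) (P : Set (Fin 2 → ℝ)) :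
    Set (Sym2 (Fin 2 → ℝ)) :=
  {e ∈ E T | openEdge e ⊆ frontier P}

end LatticePolygon

end

namespace LatticePolygon

open MeasureTheory Geometry Filter Topology

/-! For `n ≠ 0` the dilate `nP` is the disjoint union of the `n`-dilated relative interiors of the
faces of the triangulation (`momentMatrix_smul`), so the moment matrix is a sum of contributions
`faceSum` of vertices, edges and triangles. Lattice points have integer coefficients with respect to
a unimodular triangle, so those inside a dilated face are exactly the combinations with positive
integer weights of sum `n`. Summing over these weights writes each edge and triangle contribution
through `endSq` (that is, `y² + z²`) and `sumSq` (that is, `(y + z)²`) of the edges involved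
(`faceSum_pair`, `faceSum_triple`).

Two incidence counts then collect the terms. A boundary edge lies in one triangle and any other edge
in two (`sum_triangles_sum_edges`); with these multiplicities the `endSq` terms of interior edges
cancel between edges and triangles. Each boundary lattice point lies on two boundary edges
(`sum_bdE_endSq`), which turns the remaining `endSq` terms into a sum over `∂V`. The term linear in
`n` uses `(y - z)² = 2(y² + z²) - (y + z)²`.

The incidence counts are the geometric core. They rest on supporting functionals of the convex set
`P` and on the fact that near a point only the faces containing that point occur. -/

/-- The plane `ℝ²`. -/
abbrev Plane := Fin 2 → ℝ

/-! ### Determinants and areas of triangles. -/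

/-- The determinant of two vectors of the plane. -/
def det2 (a b : Plane) : ℝ := a 0 * b 1 - a 1 * b 0

/-- Twice the signed area of the triangle `a b c`. -/
def orient (a b c : Plane) : ℝ := det2 (b - a) (c - a)

theorem det2_swap (a b : Plane) : det2 b a = -det2 a b := by simp [det2]; ring

theorem det2_add_right (a b c : Plane) : det2 a (b + c) = det2 a b + det2 a c := by
  simp [det2]; ring

theorem det2_smul_right (r : ℝ) (a b : Plane) : det2 a (r • b) = r * det2 a b := by
  simp [det2]; ring

/-- Cramer's rule without division. Applying a supporting functional to it relates the values of
that functional at three points to signed areas. -/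
theorem det2_smul_eq (a b c : Plane) : det2 a b • c = det2 c b • a + det2 a c • b := by
  ext i
  fin_cases i <;> simp [det2] <;> ring

theorem orient_swap (a b c : Plane) : orient b a c = -orient a b c := by
  simp [orient, det2]; ring

theorem orient_swap_right (a b c : Plane) : orient a c b = -orient a b c := by
  simp [orient, det2]; ring

theorem mem_convexHull_triple {a b c x : Plane} :
    x ∈ convexHull ℝ ({a, b, c} : Set Plane) ↔
      ∃ α β γ : ℝ, 0 ≤ α ∧ 0 ≤ β ∧ 0 ≤ γ ∧ α + β + γ = 1 ∧ α • a + β • b + γ • c = x := by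
  rw [convexHull_insert (by simp), convexHull_pair]
  simp only [mem_convexJoin, Set.mem_singleton_iff, exists_eq_left]
  constructor
  · rintro ⟨q, ⟨r, s, hr, hs, hrs, rfl⟩, ⟨t, u, ht, hu, htu, rfl⟩⟩
    refine ⟨t, u * r, u * s, ht, by positivity, by positivity, ?_, ?_⟩
    · rw [add_assoc, ← mul_add, hrs, mul_one, htu]
    · module
  · rintro ⟨α, β, γ, hα, hβ, hγ, h, rfl⟩
    rcases (add_nonneg hβ hγ).eq_or_lt with h0 | h0
    · have h1 : β = 0 := by linarith
      have h2 : γ = 0 := by linarith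
      have h3 : α = 1 := by linarith
      subst h1 h2 h3
      exact ⟨b, left_mem_segment ℝ b c, by simpa using left_mem_segment ℝ a b⟩
    · refine ⟨(β / (β + γ)) • b + (γ / (β + γ)) • c, ⟨_, _, by positivity, by positivity, ?_, rfl⟩,
        ⟨α, β + γ, hα, h0.le, by linarith, ?_⟩⟩
      · field_simp
      · rw [smul_add, smul_smul, smul_smul, mul_div_cancel₀ _ h0.ne', mul_div_cancel₀ _ h0.ne',
          add_assoc]

theorem volume_stdTriangle :
    volume {x : Plane | 0 ≤ x 0 ∧ 0 ≤ x 1 ∧ x 0 + x 1 ≤ 1} = 1 / 2 := by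
  have hs : MeasurableSet {p : ℝ × ℝ | 0 ≤ p.1 ∧ 0 ≤ p.2 ∧ p.1 + p.2 ≤ 1} :=
    ((isClosed_le continuous_const continuous_fst).inter
      ((isClosed_le continuous_const continuous_snd).inter
        (isClosed_le (continuous_fst.add continuous_snd) continuous_const))).measurableSet
  have h := (volume_preserving_finTwoArrow ℝ).measure_preimage hs.nullMeasurableSet
  have hslice : ∀ x : ℝ, volume (Prod.mk x ⁻¹' {p : ℝ × ℝ | 0 ≤ p.1 ∧ 0 ≤ p.2 ∧ p.1 + p.2 ≤ 1})
      = (Set.Icc (0 : ℝ) 1).indicator (fun x => ENNReal.ofReal (1 - x)) x := by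
    intro x
    by_cases hx : x ∈ Set.Icc (0 : ℝ) 1
    · rw [Set.indicator_of_mem hx]
      have : Prod.mk x ⁻¹' {p : ℝ × ℝ | 0 ≤ p.1 ∧ 0 ≤ p.2 ∧ p.1 + p.2 ≤ 1} =
          Set.Icc 0 (1 - x) := by
        ext y
        simp only [Set.mem_preimage, Set.mem_ofPred_eq, Set.mem_Icc]
        constructor
        · rintro ⟨_, h1, h2⟩; exact ⟨h1, by linarith⟩
        · rintro ⟨h1, h2⟩; exact ⟨hx.1, h1, by linarith⟩
      rw [this, Real.volume_Icc, sub_zero]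
    · rw [Set.indicator_of_notMem hx]
      have : Prod.mk x ⁻¹' {p : ℝ × ℝ | 0 ≤ p.1 ∧ 0 ≤ p.2 ∧ p.1 + p.2 ≤ 1} = ∅ := by
        ext y
        simp only [Set.mem_preimage, Set.mem_ofPred_eq, Set.mem_empty_iff_false, iff_false]
        rintro ⟨h1, h2, h3⟩
        exact hx ⟨h1, by linarith⟩
      rw [this, measure_empty]
  have hint : ∫⁻ x in Set.Icc (0 : ℝ) 1, ENNReal.ofReal (1 - x) = 1 / 2 := by
    rw [← ofReal_integral_eq_lintegral_ofReal]
    · rw [integral_Icc_eq_integral_Ioc, ← intervalIntegral.integral_of_le zero_le_one]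
      have : ∫ x in (0 : ℝ)..1, (1 - x) = 1 / 2 := by
        rw [intervalIntegral.integral_sub (by simp) (by simp)]
        simp; norm_num
      rw [this]
      simp [ENNReal.ofReal_inv_of_pos]
    · exact (continuous_const.sub continuous_id).continuousOn.integrableOn_Icc
    · refine (ae_restrict_iff' measurableSet_Icc).2 (Filter.Eventually.of_forall fun x hx => ?_)
      simpa using hx.2
  rw [Measure.volume_eq_prod, Measure.prod_apply hs] at h
  simp_rw [hslice] at h
  rw [lintegral_indicator measurableSet_Icc, hint] at h
  rw [← h]
  rfl

theorem volume_convexHull_triple (a b c : Plane) :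
    volume (convexHull ℝ ({a, b, c} : Set Plane)) = ENNReal.ofReal |orient a b c| * (1 / 2) := by
  let M : Matrix (Fin 2) (Fin 2) ℝ := !![b 0 - a 0, c 0 - a 0; b 1 - a 1, c 1 - a 1]
  have hset : convexHull ℝ ({a, b, c} : Set Plane) =
      a +ᵥ (Matrix.toLin' M '' {x : Plane | 0 ≤ x 0 ∧ 0 ≤ x 1 ∧ x 0 + x 1 ≤ 1}) := by
    ext x
    rw [mem_convexHull_triple, Set.mem_vadd_set]
    constructor
    · rintro ⟨α, β, γ, hα, hβ, hγ, h, rfl⟩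
      obtain rfl : α = 1 - β - γ := by linarith
      refine ⟨_, ⟨![β, γ], ⟨by simpa, by simpa, by simp; linarith⟩, rfl⟩, ?_⟩
      ext i
      fin_cases i <;> simp [M] <;> ring
    · rintro ⟨_, ⟨y, ⟨h0, h1, h2⟩, rfl⟩, rfl⟩
      refine ⟨1 - y 0 - y 1, y 0, y 1, by linarith, h0, h1, by ring, ?_⟩
      ext i
      fin_cases i <;> simp [M, dotProduct] <;> ring
  rw [hset, measure_vadd, Measure.addHaar_image_linearMap, volume_stdTriangle,
    LinearMap.det_toLin', Matrix.det_fin_two]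
  congr 3
  simp [M, orient, det2]
  ring_nf

theorem abs_orient_eq_one_of_volume {a b c : Plane}
    (h : volume (convexHull ℝ ({a, b, c} : Set Plane)) = 1 / 2) : |orient a b c| = 1 := by
  rw [volume_convexHull_triple] at h
  have h2 := congrArg ENNReal.toReal h
  rw [ENNReal.toReal_mul, ENNReal.toReal_ofReal (abs_nonneg _)] at h2
  have h3 : (1 / 2 : ENNReal).toReal = 1 / 2 := by simp
  rw [h3] at h2
  linarith

/-! ### Lattice points and integrality of coefficients. -/

theorem orient_affine_comb (a b c : Plane) {i j k r : ℝ} (h : i + j + k = r) (u : Plane)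
    (hu : i • a + j • b + k • c = u) :
    det2 (u - r • a) (c - a) = j * orient a b c := by
  subst h hu
  simp [orient, det2]; ring

theorem exists_int_det2 {a b : Plane} (ha : a ∈ lattice) (hb : b ∈ lattice) :
    ∃ m : ℤ, det2 a b = m := by
  obtain ⟨p, rfl⟩ := ha
  obtain ⟨q, rfl⟩ := hb
  exact ⟨p 0 * q 1 - p 1 * q 0, by simp [det2]⟩

theorem lattice_sub {a b : Plane} (ha : a ∈ lattice) (hb : b ∈ lattice) : a - b ∈ lattice := by
  obtain ⟨p, rfl⟩ := ha
  obtain ⟨q, rfl⟩ := hb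
  exact ⟨p - q, by ext; simp⟩

theorem lattice_add {a b : Plane} (ha : a ∈ lattice) (hb : b ∈ lattice) : a + b ∈ lattice := by
  obtain ⟨p, rfl⟩ := ha
  obtain ⟨q, rfl⟩ := hb
  exact ⟨p + q, by ext; simp⟩

theorem lattice_nsmul {a : Plane} (ha : a ∈ lattice) (n : ℕ) : (n : ℝ) • a ∈ lattice := by
  obtain ⟨p, rfl⟩ := ha
  exact ⟨fun i => n * p i, by ext; simp⟩

/-- By `orient_affine_comb`, `j` times the area determinant `±1` is a determinant of lattice
vectors. The other coefficients follow by permuting the vertices. -/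
theorem exists_int_coeff {a b c x : Plane} (ha : a ∈ lattice)
    (hc : c ∈ lattice) (hx : x ∈ lattice) (ho : |orient a b c| = 1) {i j k : ℝ} {n : ℕ}
    (hs : i + j + k = n) (he : i • a + j • b + k • c = x) : ∃ m : ℤ, j = m := by
  have h := orient_affine_comb a b c hs x he
  obtain ⟨m, hm⟩ := exists_int_det2 (lattice_sub hx (lattice_nsmul ha n)) (lattice_sub hc ha)
  rw [hm] at h
  rcases eq_or_eq_neg_of_abs_eq ho with h1 | h1 <;> rw [h1] at h
  · exact ⟨m, by linarith⟩
  · exact ⟨-m, by push_cast; linarith⟩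

theorem finite_lattice_inter {A : Set Plane} (hA : Bornology.IsBounded A) :
    (A ∩ lattice).Finite := by
  obtain ⟨R, hR⟩ := hA.subset_closedBall 0
  obtain ⟨N, hN⟩ := exists_nat_ge R
  refine ((Set.finite_Icc (fun _ : Fin 2 => -(N : ℤ)) (fun _ => (N : ℤ))).image
    fun m : Fin 2 → ℤ => fun i => (m i : ℝ)).subset ?_
  rintro _ ⟨hx, m, rfl⟩
  refine ⟨m, ?_, rfl⟩
  have h := mem_closedBall_zero_iff.1 (hR hx)
  have h' : ∀ i, |m i| ≤ (N : ℤ) := fun i => by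
    have : ‖(m i : ℝ)‖ ≤ N := ((norm_le_pi_norm _ i).trans h).trans hN
    rw [Real.norm_eq_abs] at this
    exact_mod_cast this
  exact ⟨fun i => (abs_le.1 (h' i)).1, fun i => (abs_le.1 (h' i)).2⟩

/-! ### Relative interiors of faces. -/

/-- The convex combinations of `s` all of whose weights are positive. -/
def openHull (s : Finset Plane) : Set Plane :=
  {x | ∃ w : Plane → ℝ, (∀ v ∈ s, 0 < w v) ∧ ∑ v ∈ s, w v = 1 ∧ ∑ v ∈ s, w v • v = x}

theorem exists_mem_openHull {s : Finset Plane} {x : Plane}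
    (hx : x ∈ convexHull ℝ (s : Set Plane)) : ∃ t ⊆ s, t.Nonempty ∧ x ∈ openHull t := by
  obtain ⟨w, h0, h1, h2⟩ := Finset.mem_convexHull'.1 hx
  have hsum : ∑ v ∈ s with w v ≠ 0, w v = 1 := by rw [Finset.sum_filter_ne_zero, h1]
  refine ⟨s.filter fun v => w v ≠ 0, Finset.filter_subset _ _, ?_, w, ?_, hsum, ?_⟩
  · by_contra h
    rw [Finset.not_nonempty_iff_eq_empty] at h
    simp [h] at hsum
  · intro v hv
    rw [Finset.mem_filter] at hv
    exact (h0 v hv.1).lt_of_ne' hv.2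
  · rw [← h2]
    refine Finset.sum_filter_of_ne fun v _ hv h => hv ?_
    rw [h, zero_smul]

theorem openHull_subset_convexHull (s : Finset Plane) :
    openHull s ⊆ convexHull ℝ (s : Set Plane) := by
  rintro x ⟨w, h0, h1, h2⟩
  exact Finset.mem_convexHull'.2 ⟨w, fun v hv => (h0 v hv).le, h1, h2⟩

theorem mem_openHull_pair {y z x : Plane} (h : y ≠ z) :
    x ∈ openHull {y, z} ↔ ∃ α β : ℝ, 0 < α ∧ 0 < β ∧ α + β = 1 ∧ α • y + β • z = x := by
  constructor
  · rintro ⟨w, h0, h1, h2⟩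
    rw [Finset.sum_pair h] at h1 h2
    exact ⟨w y, w z, h0 _ (by simp), h0 _ (by simp), h1, h2⟩
  · rintro ⟨α, β, hα, hβ, h1, h2⟩
    refine ⟨fun v => if v = y then α else β, ?_, ?_, ?_⟩
    · intro v _
      dsimp only
      split_ifs <;> assumption
    · rw [Finset.sum_pair h]; simp [h.symm, h1]
    · rw [Finset.sum_pair h]; simp [h.symm, h2]

theorem openHull_pair {y z : Plane} (h : y ≠ z) : openHull {y, z} = openSegment ℝ y z := by
  ext x
  rw [mem_openHull_pair h]
  rfl

theorem mem_openHull_triple {a b c x : Plane} (hab : a ≠ b) (hac : a ≠ c) (hbc : b ≠ c) :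
    x ∈ openHull {a, b, c} ↔
      ∃ α β γ : ℝ, 0 < α ∧ 0 < β ∧ 0 < γ ∧ α + β + γ = 1 ∧ α • a + β • b + γ • c = x := by
  have key : ∀ {M : Type} [AddCommMonoid M] (f : Plane → M),
      ∑ v ∈ {a, b, c}, f v = f a + f b + f c := fun f => by
    rw [Finset.sum_insert (by simp [hab, hac]), Finset.sum_pair hbc, add_assoc]
  constructor
  · rintro ⟨w, h0, h1, h2⟩
    rw [key] at h1 h2
    exact ⟨w a, w b, w c, h0 _ (by simp), h0 _ (by simp), h0 _ (by simp), h1, h2⟩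
  · rintro ⟨α, β, γ, hα, hβ, hγ, h1, h2⟩
    refine ⟨fun v => if v = a then α else if v = b then β else γ, ?_, ?_, ?_⟩
    · intro v _
      dsimp only
      split_ifs <;> assumption
    · rw [key]; simp [hab.symm, hac.symm, hbc.symm, h1]
    · rw [key]; simp [hab.symm, hac.symm, hbc.symm, h2]

theorem mem_openHull_singleton {a x : Plane} : x ∈ openHull {a} ↔ x = a := by
  constructor
  · rintro ⟨w, _, h1, h2⟩
    rw [Finset.sum_singleton] at h1 h2
    rw [← h2, h1, one_smul]
  · rintro rfl
    exact ⟨fun _ => 1, by simp, by simp, by simp⟩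

variable {T : SimplicialComplex ℝ Plane} {P : Set Plane}

/-- The point also lies in the hull of `s ∩ t`. Affine independence of `s` makes its weights unique,
so a vertex of `s` outside `t` would have weight zero, against positivity. -/
theorem subset_of_mem_openHull {s t : Finset Plane} (hs : s ∈ T.faces) (ht : t ∈ T.faces)
    {x : Plane} (hxs : x ∈ openHull s) (hxt : x ∈ convexHull ℝ (t : Set Plane)) : s ⊆ t := by
  have hx := T.inter_subset_convexHull hs ht ⟨openHull_subset_convexHull s hxs, hxt⟩
  rw [← Finset.coe_inter] at hx
  obtain ⟨w', -, h1', h2'⟩ := Finset.mem_convexHull'.1 hx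
  obtain ⟨w, h0, h1, h2⟩ := hxs
  have hind := T.indep hs
  have hsub : s ∩ t ⊆ s := Finset.inter_subset_left
  set u : Plane → ℝ := fun v => w v - if v ∈ t then w' v else 0 with hu
  have e1 : ∑ v ∈ s, u v = 0 := by
    rw [hu, Finset.sum_sub_distrib, h1, ← Finset.sum_filter, Finset.filter_mem_eq_inter, h1',
      sub_self]
  have e2 : ∑ v ∈ s, u v • v = 0 := by
    simp only [hu, sub_smul, ite_smul, zero_smul]
    rw [Finset.sum_sub_distrib, h2, ← Finset.sum_filter, Finset.filter_mem_eq_inter, h2', sub_self]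
  intro v hv
  by_contra hvt
  have h3 := (affineIndependent_iff.1 hind) Finset.univ (fun v => u v)
    (by rw [← e1]; exact Finset.sum_coe_sort s u)
    (by rw [← e2]; exact Finset.sum_coe_sort s fun v => u v • v) ⟨v, hv⟩ (Finset.mem_univ _)
  simp only [hu, hvt, if_false, sub_zero] at h3
  exact (h0 v hv).ne' h3

theorem eq_of_mem_openHull {s t : Finset Plane} (hs : s ∈ T.faces) (ht : t ∈ T.faces)
    {x : Plane} (hxs : x ∈ openHull s) (hxt : x ∈ openHull t) : s = t :=
  (subset_of_mem_openHull hs ht hxs (openHull_subset_convexHull t hxt)).antisymm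
    (subset_of_mem_openHull ht hs hxt (openHull_subset_convexHull s hxs))

theorem exists_face_openHull {x : Plane} (hx : x ∈ T.space) : ∃ s ∈ T.faces, x ∈ openHull s := by
  obtain ⟨s, hs, hxs⟩ := SimplicialComplex.mem_space_iff.1 hx
  obtain ⟨t, hts, htn, hxt⟩ := exists_mem_openHull hxs
  exact ⟨t, T.down_closed hs hts htn, hxt⟩

/-- Near a point, the points of a face belong to a face that contains the given point. -/
theorem eventually_mem_convexHull_face (hT : T.faces.Finite) (x : Plane) :
    ∀ᶠ p in 𝓝 x, ∀ t ∈ T.faces, p ∈ convexHull ℝ (t : Set Plane) →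
      x ∈ convexHull ℝ (t : Set Plane) := by
  rw [Filter.eventually_all_finite hT]
  intro t _
  by_cases h : x ∈ convexHull ℝ (t : Set Plane)
  · exact Eventually.of_forall fun _ _ => h
  · filter_upwards [(t.finite_toSet.isClosed_convexHull ℝ).isOpen_compl.mem_nhds h] with p hp hp'
    exact absurd hp' hp

/-! ### Triangles on the two sides of an edge. -/

theorem card_face_le {s : Finset Plane} (hs : s ∈ T.faces) : s.card ≤ 3 := by
  have h := (T.indep hs).card_le_finrank_succ
  rw [Fintype.card_coe] at h
  exact h.trans (Nat.succ_le_succ ((Submodule.finrank_le _).trans (by simp)))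

theorem orient_ne_zero {a b c : Plane} (h : {a, b, c} ∈ T.faces) (hab : a ≠ b) (hac : a ≠ c)
    (hbc : b ≠ c) : orient a b c ≠ 0 := by
  intro h0
  have hind := T.indep h
  have main : ∀ u v w : ℝ, u + v + w = 0 → u • a + v • b + w • c = 0 → u = 0 ∧ v = 0 ∧ w = 0 := by
    intro u v w h1 h2
    have key : ∀ {M : Type} [AddCommMonoid M] (f : Plane → M),
        ∑ v ∈ {a, b, c}, f v = f a + f b + f c := fun f => by
      rw [Finset.sum_insert (by simp [hab, hac]), Finset.sum_pair hbc, add_assoc]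
    let g : Plane → ℝ := fun p => if p = a then u else if p = b then v else w
    have h3 := (affineIndependent_iff.1 hind) Finset.univ (fun p => g p)
      (by rw [Finset.sum_coe_sort {a, b, c} g, key]; simp [g, hab.symm, hac.symm, hbc.symm, h1])
      (by
        rw [Finset.sum_coe_sort {a, b, c} fun p => g p • p, key]
        simp [g, hab.symm, hac.symm, hbc.symm, h2])
    have ha := h3 ⟨a, by simp⟩ (Finset.mem_univ _)
    have hb := h3 ⟨b, by simp⟩ (Finset.mem_univ _)
    have hc := h3 ⟨c, by simp⟩ (Finset.mem_univ _)
    simp [g, hab.symm, hac.symm, hbc.symm] at ha hb hc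
    exact ⟨ha, hb, hc⟩
  have hcoord : ∀ i, c i = a i := fun i => by
    -- For these weights coordinate `i` of the combination vanishes identically and the other
    -- coordinate is `±orient a b c`, which is zero.
    have := (main ((b i - c i)) (c i - a i) (a i - b i) (by ring) (by
      simp only [orient, det2, Pi.sub_apply] at h0
      ext j
      fin_cases i <;> fin_cases j <;> simp <;> linarith)).2.1
    linarith
  exact hac (funext hcoord).symm

theorem orient_comb (y z : Plane) {w p : Plane} {α β γ : ℝ} (h : α + β + γ = 1)
    (hp : α • y + β • z + γ • w = p) : orient y z p = γ * orient y z w := by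
  obtain rfl : α = 1 - β - γ := by linarith
  subst hp
  simp [orient, det2]; ring

theorem orient_left_self (y z : Plane) : orient y z y = 0 := by simp [orient, det2]

theorem orient_right_self (y z : Plane) : orient y z z = 0 := by simp [orient, det2]; ring

theorem orient_self (y z : Plane) : orient y y z = 0 := by simp [orient, det2]

theorem ne_of_orient_ne_zero {a b c : Plane} (h : orient a b c ≠ 0) :
    a ≠ b ∧ a ≠ c ∧ b ≠ c := by
  refine ⟨?_, ?_, ?_⟩ <;> rintro rfl
  · exact h (orient_self _ _)
  · exact h (orient_left_self _ _)
  · exact h (orient_right_self _ _)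

theorem exists_orient_pos {y z : Plane} (h : y ≠ z) : ∃ v : Plane, 0 < det2 (z - y) v := by
  refine ⟨![-(z 1 - y 1), z 0 - y 0], ?_⟩
  have : y 0 ≠ z 0 ∨ y 1 ≠ z 1 := by
    by_contra! hc
    exact h (funext fun i => by fin_cases i; exacts [hc.1, hc.2])
  simp only [det2, Pi.sub_apply, Matrix.cons_val_zero, Matrix.cons_val_one]
  rcases this with h | h
  · have := sq_pos_of_ne_zero (sub_ne_zero.2 h)
    nlinarith [sq_nonneg (y 1 - z 1)]
  · have := sq_pos_of_ne_zero (sub_ne_zero.2 h)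
    nlinarith [sq_nonneg (y 0 - z 0)]

theorem orient_add_smul (y z : Plane) {α β : ℝ} (h : α + β = 1) (ε : ℝ) (v : Plane) :
    orient y z (α • y + β • z + ε • v) = ε * det2 (z - y) v := by
  obtain rfl : α = 1 - β := by linarith
  simp [orient, det2]; ring

theorem tendsto_add_smul (m v : Plane) : Tendsto (fun ε : ℝ => m + ε • v) (𝓝[>] 0) (𝓝 m) := by
  have : Continuous fun ε : ℝ => m + ε • v := by fun_prop
  have h := this.tendsto 0
  simp only [zero_smul, add_zero] at h
  exact h.mono_left nhdsWithin_le_nhds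

/-- A face whose hull meets the open edge contains the edge. Since it also reaches the point `p` off
the line, it is a triangle, and the side of `p` is the side of its third vertex. -/
theorem exists_apex_of_orient_pos {y z m p : Plane} (hyz : y ≠ z) (hE : {y, z} ∈ T.faces)
    (hm : m ∈ openHull {y, z}) {t : Finset Plane} (ht : t ∈ T.faces)
    (hmt : m ∈ convexHull ℝ (t : Set Plane)) (hpt : p ∈ convexHull ℝ (t : Set Plane))
    (hp : 0 < orient y z p) : ∃ w, {y, z, w} ∈ T.faces ∧ 0 < orient y z w := by
  have hsub := subset_of_mem_openHull hE ht hm hmt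
  have hcard := card_face_le ht
  have h2 : ({y, z} : Finset Plane).card = 2 := Finset.card_pair hyz
  rcases hsub.eq_or_ssubset with h | h
  · exfalso
    rw [← h, Finset.coe_pair, convexHull_pair] at hpt
    obtain ⟨α, β, _, _, h1, rfl⟩ := hpt
    have := orient_add_smul y z h1 0 0
    simp only [smul_zero, add_zero, zero_mul] at this
    exact hp.ne' this
  · obtain ⟨w, hwt, hw⟩ := Finset.exists_of_ssubset h
    have heq : {y, z, w} = t := by
      refine Finset.eq_of_subset_of_card_le ?_ ?_
      · intro v hv
        simp only [Finset.mem_insert, Finset.mem_singleton] at hv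
        rcases hv with rfl | rfl | rfl
        · exact hsub (by simp)
        · exact hsub (by simp)
        · exact hwt
      · simp only [Finset.mem_insert, Finset.mem_singleton, not_or] at hw
        rw [Finset.card_insert_of_notMem (by simp [hyz, Ne.symm hw.1]),
          Finset.card_pair (Ne.symm hw.2)]
        exact hcard
    refine ⟨w, heq ▸ ht, ?_⟩
    rw [← heq, Finset.coe_insert, Finset.coe_pair, mem_convexHull_triple] at hpt
    obtain ⟨α, β, γ, _, _, hγ, h1, h2⟩ := hpt
    rw [orient_comb y z h1 h2] at hp
    exact pos_of_mul_pos_right hp hγ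

/-- Two triangles on the same side of an edge overlap: the midpoint of the edge, pushed slightly
towards `w'`, is in the open triangle `y z w` and in the closed triangle `y z w'`. -/
theorem apex_unique {y z w w' : Plane} (hw : {y, z, w} ∈ T.faces) (hw' : {y, z, w'} ∈ T.faces)
    (ho : 0 < orient y z w) (ho' : 0 < orient y z w') : w = w' := by
  obtain ⟨hyz, hyw, hzw⟩ := ne_of_orient_ne_zero ho.ne'
  set D := orient y z w with hD
  -- Barycentric coordinates of `w'` in the triangle `y z w`; only `γ` is known to be positive.
  set β := orient y w' w / D
  set α := orient w' z w / D
  set γ := orient y z w' / D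
  have hγ : 0 < γ := div_pos ho' ho
  have hsum : α + β + γ = 1 := by
    rw [← add_div, ← add_div, div_eq_one_iff_eq ho.ne', hD]
    simp [orient, det2]; ring
  have hw'e : α • y + β • z + γ • w = w' := by
    have h1 : orient w' z w • y + orient y w' w • z + orient y z w' • w = D • w' := by
      ext i
      fin_cases i <;> simp [hD, orient, det2] <;> ring
    have h2 : α • y + β • z + γ • w = D⁻¹ • (D • w') := by
      rw [← h1]
      simp only [α, β, γ, div_eq_inv_mul]
      module
    rw [h2, inv_smul_smul₀ ho.ne']
  have hev : ∀ᶠ ε : ℝ in 𝓝[>] 0, 0 < (1 - ε) / 2 + ε * α ∧ 0 < (1 - ε) / 2 + ε * β ∧ ε < 1 := by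
    have c : ∀ r : ℝ, Tendsto (fun ε : ℝ => (1 - ε) / 2 + ε * r) (𝓝[>] 0) (𝓝 (1 / 2)) := by
      intro r
      have : Continuous fun ε : ℝ => (1 - ε) / 2 + ε * r := by fun_prop
      have h := this.tendsto 0
      simp only [sub_zero, zero_mul, add_zero] at h
      exact h.mono_left nhdsWithin_le_nhds
    exact ((c α).eventually (lt_mem_nhds (by norm_num))).and
      (((c β).eventually (lt_mem_nhds (by norm_num))).and
        (nhdsWithin_le_nhds (gt_mem_nhds one_pos)))
  obtain ⟨ε, ⟨h1, h2, h3⟩, h0⟩ := (hev.and self_mem_nhdsWithin).exists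
  have h0 : 0 < ε := h0
  have hmem : ((1 - ε) / 2) • y + ((1 - ε) / 2) • z + ε • w' ∈ openHull {y, z, w} := by
    rw [mem_openHull_triple hyz hyw hzw]
    refine ⟨_, _, ε * γ, h1, h2, by positivity, by linear_combination ε * hsum, ?_⟩
    rw [← hw'e]
    module
  have hmem' : ((1 - ε) / 2) • y + ((1 - ε) / 2) • z + ε • w' ∈
      convexHull ℝ (({y, z, w'} : Finset Plane) : Set Plane) := by
    rw [Finset.coe_insert, Finset.coe_pair, mem_convexHull_triple]
    exact ⟨_, _, _, by linarith, by linarith, h0.le, by ring, rfl⟩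
  have := subset_of_mem_openHull hw hw' hmem hmem' (show w ∈ _ by simp)
  simpa [hyw.symm, hzw.symm] using this

theorem exists_apex_of_mem_interior (hT : T.faces.Finite) (hP : T.space = P) {y z m : Plane}
    (hyz : y ≠ z) (hE : {y, z} ∈ T.faces) (hm : m ∈ openHull {y, z}) (hmP : m ∈ interior P) :
    ∃ w, {y, z, w} ∈ T.faces ∧ 0 < orient y z w := by
  obtain ⟨v, hv⟩ := exists_orient_pos hyz
  have h1 := (tendsto_add_smul m v).eventually
    ((eventually_mem_convexHull_face hT m).and (mem_interior_iff_mem_nhds.1 hmP))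
  obtain ⟨ε, ⟨hstar, hpP⟩, h0⟩ := (h1.and self_mem_nhdsWithin).exists
  have h0 : 0 < ε := h0
  rw [← hP] at hpP
  obtain ⟨t, ht, hpt⟩ := SimplicialComplex.mem_space_iff.1 hpP
  refine exists_apex_of_orient_pos hyz hE hm ht (hstar t ht hpt) hpt ?_
  obtain ⟨α, β, _, _, hs, rfl⟩ := (mem_openHull_pair hyz).1 hm
  rw [orient_add_smul y z hs]
  positivity

/-- Interior points of `P` accumulate at the midpoint of the edge, so some nearby one is off its
line; the face containing that point is the triangle sought. -/
theorem exists_apex (hT : T.faces.Finite) (hP : T.space = P) (hcl : P ⊆ closure (interior P))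
    {y z : Plane} (hyz : y ≠ z) (hE : {y, z} ∈ T.faces) :
    ∃ w, {y, z, w} ∈ T.faces ∧ orient y z w ≠ 0 := by
  have hm : (1 / 2 : ℝ) • y + (1 / 2 : ℝ) • z ∈ openHull {y, z} :=
    (mem_openHull_pair hyz).2 ⟨_, _, by norm_num, by norm_num, by norm_num, rfl⟩
  set m := (1 / 2 : ℝ) • y + (1 / 2 : ℝ) • z
  have hmP : m ∈ P := hP ▸ SimplicialComplex.convexHull_subset_space hE
    (openHull_subset_convexHull _ hm)
  obtain ⟨U, hU, hUo, hmU⟩ := eventually_nhds_iff.1 (eventually_mem_convexHull_face hT m)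
  obtain ⟨q, hqU, hqP⟩ := mem_closure_iff.1 (hcl hmP) U hUo hmU
  obtain ⟨v, hv⟩ := exists_orient_pos hyz
  obtain ⟨p, hpU, hpP, hp0⟩ : ∃ p ∈ U, p ∈ interior P ∧ orient y z p ≠ 0 := by
    -- If the interior point found lies on the line of the edge, it is pushed off that line within
    -- the same open set.
    by_cases h0 : orient y z q = 0
    · obtain ⟨ε, hε, h1⟩ := (((tendsto_add_smul q v).eventually
        ((hUo.inter isOpen_interior).mem_nhds ⟨hqU, hqP⟩)).and self_mem_nhdsWithin).exists
      refine ⟨_, hε.1, hε.2, ?_⟩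
      have : orient y z (q + ε • v) = orient y z q + ε * det2 (z - y) v := by
        simp [orient, det2]; ring
      rw [this, h0, zero_add]
      exact (mul_pos h1 hv).ne'
    · exact ⟨q, hqU, hqP, h0⟩
  have hpT : p ∈ T.space := hP ▸ interior_subset hpP
  obtain ⟨t, ht, hpt⟩ := SimplicialComplex.mem_space_iff.1 hpT
  rcases hp0.lt_or_gt with h | h
  · obtain ⟨w, hw, ho⟩ := exists_apex_of_orient_pos (y := z) (z := y) hyz.symm
      (by rwa [Finset.pair_comm]) (by rwa [Finset.pair_comm]) ht (hU p hpU t ht hpt) hpt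
      (by rw [orient_swap]; linarith)
    refine ⟨w, by rwa [Finset.insert_comm], ?_⟩
    rw [orient_swap] at ho
    linarith
  · obtain ⟨w, hw, ho⟩ := exists_apex_of_orient_pos hyz hE hm ht (hU p hpU t ht hpt) hpt h
    exact ⟨w, hw, ho.ne'⟩

/-! ### Supporting functionals and the number of triangles at an edge. -/

/-- A supporting linear functional at a point outside the interior of a convex body. -/
theorem exists_support (hconv : Convex ℝ P) (hcl : P ⊆ closure (interior P))
    {m : Plane} (hm : m ∉ interior P) :
    ∃ f : Plane →L[ℝ] ℝ, (∀ p ∈ P, f p ≤ f m) ∧ ∀ p ∈ interior P, f p < f m := by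
  obtain ⟨f, hf⟩ := geometric_hahn_banach_open_point hconv.interior isOpen_interior hm
  refine ⟨f, fun p hp => ?_, hf⟩
  exact closure_minimal (fun q hq => (hf q hq).le) (isClosed_le f.continuous continuous_const)
    (hcl hp)

/-- Otherwise a functional supporting `P` at `m` would be constant on the segment, hence have
opposite signs relative to that constant on the two sides. Two apices force it to be constant
everywhere, contradicting strictness on the interior. -/
theorem mem_interior_of_two_apices (hconv : Convex ℝ P) (hcl : P ⊆ closure (interior P))
    (hne : (interior P).Nonempty) {y z w w' m : Plane} (hy : y ∈ P) (hz : z ∈ P) (hw : w ∈ P)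
    (hw' : w' ∈ P) (ho : 0 < orient y z w) (ho' : orient y z w' < 0)
    (hm : m ∈ openSegment ℝ y z) : m ∈ interior P := by
  by_contra hmi
  obtain ⟨f, hf, hfi⟩ := exists_support hconv hcl hmi
  obtain ⟨q, hq⟩ := hne
  have hqm := hfi q hq
  have h1 := hf y hy
  have h2 := hf z hz
  have h3 := hf w hw
  have h4 := hf w' hw'
  obtain ⟨α, β, hα, hβ, hs, rfl⟩ := hm
  have hfm : f (α • y + β • z) = α * f y + β * f z := by simp
  rw [hfm] at hqm h1 h2 h3 h4
  obtain rfl : α = 1 - β := by linarith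
  have e1 : f y ≤ f z := by nlinarith
  have e2 : f z ≤ f y := by nlinarith
  have e3 : f z = f y := le_antisymm e2 e1
  -- As `f` is constant along `y z`, `f c - f y` is proportional to the signed area `orient y z c`.
  have key : ∀ c : Plane, orient y z w * (f c - f y) = orient y z c * (f w - f y) := by
    intro c
    have := congrArg f (det2_smul_eq (z - y) (w - y) (c - y))
    simp only [map_smul, map_add, map_sub, smul_eq_mul, e3, sub_self, mul_zero, zero_add] at this
    exact this
  rw [e3] at hqm h3 h4
  have hw0 : f w - f y = 0 := by
    have := key w'
    have h5 : f w - f y ≤ 0 := by nlinarith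
    have h6 : f w' - f y ≤ 0 := by nlinarith
    nlinarith
  have := key q
  rw [hw0, mul_zero] at this
  have := (mul_eq_zero.1 this).resolve_left ho.ne'
  nlinarith

theorem mem_E {y z : Plane} : s(y, z) ∈ E T ↔ y ≠ z ∧ {y, z} ∈ T.faces := Iff.rfl

theorem mem_bdE {y z : Plane} :
    s(y, z) ∈ bdE T P ↔ (y ≠ z ∧ {y, z} ∈ T.faces) ∧ openSegment ℝ y z ⊆ frontier P := Iff.rfl

theorem mem_intE {y z : Plane} :
    s(y, z) ∈ intE T P ↔ (y ≠ z ∧ {y, z} ∈ T.faces) ∧ ¬ openSegment ℝ y z ⊆ frontier P := Iff.rfl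

theorem exists_third_vertex {y z : Plane} (hyz : y ≠ z) {t : Finset Plane} (ht : t ∈ T.faces)
    (h3 : t.card = 3) (hsub : {y, z} ⊆ t) : ∃ w, t = {y, z, w} ∧ orient y z w ≠ 0 := by
  obtain ⟨w, hw⟩ : ∃ w, t \ {y, z} = {w} := by
    rw [← Finset.card_eq_one, Finset.card_sdiff_of_subset hsub, h3, Finset.card_pair hyz]
  have hmem : w ∈ t \ {y, z} := hw ▸ Finset.mem_singleton_self w
  simp only [Finset.mem_sdiff, Finset.mem_insert, Finset.mem_singleton, not_or] at hmem
  have heq : t = {y, z, w} := by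
    rw [← Finset.union_sdiff_of_subset hsub, hw]
    ext
    simp
  subst heq
  exact ⟨w, rfl, orient_ne_zero ht hyz (Ne.symm hmem.2.1) (Ne.symm hmem.2.2)⟩

theorem card_triple {a b c : Plane} (h : orient a b c ≠ 0) : ({a, b, c} : Finset Plane).card = 3 :=
  Finset.card_eq_three.2 ⟨a, b, c, (ne_of_orient_ne_zero h).1, (ne_of_orient_ne_zero h).2.1,
    (ne_of_orient_ne_zero h).2.2, rfl⟩

theorem apex_unique_of_neg {y z w w' : Plane} (hw : {y, z, w} ∈ T.faces)
    (hw' : {y, z, w'} ∈ T.faces) (ho : orient y z w < 0) (ho' : orient y z w' < 0) : w = w' :=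
  apex_unique (y := z) (z := y) (by rwa [Finset.insert_comm]) (by rwa [Finset.insert_comm])
    (by rw [orient_swap]; linarith) (by rw [orient_swap]; linarith)

theorem exists_apex_neg_of_mem_interior (hT : T.faces.Finite) (hP : T.space = P) {y z m : Plane}
    (hyz : y ≠ z) (hE : {y, z} ∈ T.faces) (hm : m ∈ openHull {y, z}) (hmP : m ∈ interior P) :
    ∃ w, {y, z, w} ∈ T.faces ∧ orient y z w < 0 := by
  obtain ⟨w, hw, ho⟩ := exists_apex_of_mem_interior (y := z) (z := y) hT hP hyz.symm
    (by rwa [Finset.pair_comm]) (by rwa [Finset.pair_comm]) hmP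
  exact ⟨w, by rwa [Finset.insert_comm], by rw [orient_swap] at ho; linarith⟩

/-- The triangles of a finite complex in the plane. -/
noncomputable def triangles (hT : T.faces.Finite) : Finset (Finset Plane) :=
  hT.toFinset.filter fun t => t.card = 3

theorem mem_triangles {hT : T.faces.Finite} {t : Finset Plane} :
    t ∈ triangles hT ↔ t ∈ T.faces ∧ t.card = 3 := by simp [triangles]

theorem mem_of_face (hP : T.space = P) {s : Finset Plane} (hs : s ∈ T.faces) {v : Plane}
    (hv : v ∈ s) : v ∈ P := hP ▸ T.subset_space hs hv

theorem openHull_subset_of_face (hP : T.space = P) {s : Finset Plane} (hs : s ∈ T.faces) :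
    openHull s ⊆ P :=
  hP ▸ (openHull_subset_convexHull s).trans (SimplicialComplex.convexHull_subset_space hs)

theorem card_triangles_of_mem_bdE (hT : T.faces.Finite) (hP : T.space = P) (hconv : Convex ℝ P)
    (hcl : P ⊆ closure (interior P)) (hne : (interior P).Nonempty) {y z : Plane}
    (he : s(y, z) ∈ bdE T P) : ((triangles hT).filter fun t => {y, z} ⊆ t).card = 1 := by
  obtain ⟨⟨hyz, hE⟩, hfr⟩ := mem_bdE.1 he
  obtain ⟨w, hw, ho⟩ := exists_apex hT hP hcl hyz hE
  rw [Finset.card_eq_one]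
  refine ⟨{y, z, w}, ?_⟩
  ext t
  simp only [Finset.mem_filter, mem_triangles, Finset.mem_singleton]
  constructor
  · rintro ⟨⟨ht, h3⟩, hsub⟩
    obtain ⟨w', rfl, ho'⟩ := exists_third_vertex hyz ht h3 hsub
    have hm : (1 / 2 : ℝ) • y + (1 / 2 : ℝ) • z ∈ openSegment ℝ y z :=
      ⟨_, _, by norm_num, by norm_num, by norm_num, rfl⟩
    have hni : ∀ a b : Plane, {y, z, a} ∈ T.faces → {y, z, b} ∈ T.faces → 0 < orient y z a →
        orient y z b < 0 → False := fun a b ha hb hoa hob =>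
      (hfr hm).2 (mem_interior_of_two_apices hconv hcl hne (mem_of_face hP ha (by simp))
        (mem_of_face hP ha (by simp)) (mem_of_face hP ha (by simp))
        (mem_of_face hP hb (by simp)) hoa hob hm)
    rcases ho.lt_or_gt with h | h <;> rcases ho'.lt_or_gt with h' | h'
    · rw [apex_unique_of_neg hw ht h h']
    · exact (hni _ _ ht hw h' h).elim
    · exact (hni _ _ hw ht h h').elim
    · rw [apex_unique hw ht h h']
  · rintro rfl
    exact ⟨⟨hw, card_triple ho⟩, by intro v; simp; tauto⟩

theorem card_triangles_of_mem_intE (hT : T.faces.Finite) (hP : T.space = P) {y z : Plane}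
    (he : s(y, z) ∈ intE T P) : ((triangles hT).filter fun t => {y, z} ⊆ t).card = 2 := by
  obtain ⟨⟨hyz, hE⟩, hfr⟩ := mem_intE.1 he
  obtain ⟨m, hm, hmf⟩ := Set.not_subset.1 hfr
  rw [← openHull_pair hyz] at hm
  have hmP := openHull_subset_of_face hP hE hm
  have hmi : m ∈ interior P := by
    by_contra h
    exact hmf ⟨subset_closure hmP, h⟩
  obtain ⟨w, hw, ho⟩ := exists_apex_of_mem_interior hT hP hyz hE hm hmi
  obtain ⟨w', hw', ho'⟩ := exists_apex_neg_of_mem_interior hT hP hyz hE hm hmi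
  rw [Finset.card_eq_two]
  refine ⟨{y, z, w}, {y, z, w'}, ?_, ?_⟩
  · intro heq
    have hmem : w ∈ ({y, z, w'} : Finset Plane) := heq ▸ by simp
    have h1 := ne_of_orient_ne_zero ho.ne'
    simp only [Finset.mem_insert, Finset.mem_singleton, h1.2.1.symm, h1.2.2.symm, false_or] at hmem
    subst hmem
    exact lt_asymm ho ho'
  · ext t
    simp only [Finset.mem_filter, mem_triangles, Finset.mem_insert, Finset.mem_singleton]
    constructor
    · rintro ⟨⟨ht, h3⟩, hsub⟩
      obtain ⟨a, rfl, hoa⟩ := exists_third_vertex hyz ht h3 hsub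
      rcases hoa.lt_or_gt with h | h
      · exact Or.inr (by rw [apex_unique_of_neg ht hw' h ho'])
      · exact Or.inl (by rw [apex_unique ht hw h ho])
    · rintro (rfl | rfl)
      · exact ⟨⟨hw, card_triple ho.ne'⟩, by intro v; simp; tauto⟩
      · exact ⟨⟨hw', card_triple ho'.ne⟩, by intro v; simp; tauto⟩

/-! ### Boundary vertices -/

theorem exists_support_edge (hconv : Convex ℝ P) (hcl : P ⊆ closure (interior P)) {v z : Plane}
    (hv : v ∈ P) (hz : z ∈ P) (hfr : openSegment ℝ v z ⊆ frontier P) :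
    ∃ f : Plane →L[ℝ] ℝ, f z = f v ∧ (∀ p ∈ P, f p ≤ f v) ∧ ∀ p ∈ interior P, f p < f v := by
  have hm : (1 / 2 : ℝ) • v + (1 / 2 : ℝ) • z ∈ openSegment ℝ v z :=
    ⟨_, _, by norm_num, by norm_num, by norm_num, rfl⟩
  obtain ⟨f, hf, hfi⟩ := exists_support hconv hcl (hfr hm).2
  have hfm : f ((1 / 2 : ℝ) • v + (1 / 2 : ℝ) • z) = 1 / 2 * f v + 1 / 2 * f z := by simp
  rw [hfm] at hf hfi
  have h1 := hf v hv
  have h2 := hf z hz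
  have h3 : 1 / 2 * f v + 1 / 2 * f z = f v := by linarith
  rw [h3] at hf hfi
  exact ⟨f, by linarith, hf, hfi⟩

theorem orient_ne_zero_of_boundary_edge (hconv : Convex ℝ P) (hcl : P ⊆ closure (interior P))
    {v z q : Plane} (hvz : v ≠ z) (hv : v ∈ P) (hz : z ∈ P) (hq : q ∈ interior P)
    (hfr : openSegment ℝ v z ⊆ frontier P) : orient v q z ≠ 0 := by
  intro h0
  obtain ⟨f, hfz, -, hfi⟩ := exists_support_edge hconv hcl hv hz hfr
  obtain ⟨d, hd⟩ := exists_orient_pos hvz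
  have h := congrArg f (det2_smul_eq (z - v) d (q - v))
  have h1 : det2 (z - v) (q - v) = 0 := by rw [det2_swap]; exact neg_eq_zero.2 h0
  simp only [map_smul, map_add, map_sub, smul_eq_mul, hfz, sub_self, mul_zero, zero_add, h1,
    zero_mul] at h
  have := hfi q hq
  nlinarith

/-- `P` lies on one side of the line through a boundary edge: seen from `v`, no point of `P` can be
turned further from `q` than `z`. -/
theorem not_orient_pos_of_boundary_edges (hconv : Convex ℝ P) (hcl : P ⊆ closure (interior P))
    {v z z' q : Plane} (hv : v ∈ P) (hz : z ∈ P) (hz' : z' ∈ P) (hq : q ∈ interior P)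
    (hfr : openSegment ℝ v z ⊆ frontier P) {σ : ℝ} (h1 : 0 < σ * orient v q z) :
    σ * orient v z z' ≤ 0 := by
  by_contra! h
  obtain ⟨f, hfz, hf, hfi⟩ := exists_support_edge hconv hcl hv hz hfr
  have h3 := congrArg f (det2_smul_eq (q - v) (z' - v) (z - v))
  simp only [map_smul, map_add, map_sub, smul_eq_mul, hfz, sub_self, mul_zero] at h3
  have e1 := hfi q hq
  have e2 := hf z' hz'
  have h4 : σ * orient v z z' * (f q - f v) + σ * orient v q z * (f z' - f v) = 0 := by
    simp only [orient]
    linear_combination -σ * h3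
  nlinarith

/-- The preceding bound, used with `z` and `z'` in both roles, puts them on one ray from `v`. The
two edges then overlap and must coincide. -/
theorem boundary_edge_unique (hP : T.space = P) (hconv : Convex ℝ P)
    (hcl : P ⊆ closure (interior P)) {v z z' q : Plane} (hq : q ∈ interior P)
    (hz : s(v, z) ∈ bdE T P) (hz' : s(v, z') ∈ bdE T P) {σ : ℝ} (hσ : σ ≠ 0)
    (h1 : 0 < σ * orient v q z) (h2 : 0 < σ * orient v q z') : z = z' := by
  obtain ⟨⟨hvz, hE⟩, hfr⟩ := mem_bdE.1 hz
  obtain ⟨⟨hvz', hE'⟩, hfr'⟩ := mem_bdE.1 hz'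
  have hvP := mem_of_face hP hE (show v ∈ _ by simp)
  have hzP := mem_of_face hP hE (show z ∈ _ by simp)
  have hzP' := mem_of_face hP hE' (show z' ∈ _ by simp)
  have h3 := not_orient_pos_of_boundary_edges hconv hcl hvP hzP hzP' hq hfr h1
  have h4 := not_orient_pos_of_boundary_edges hconv hcl hvP hzP' hzP hq hfr' h2
  rw [orient_swap_right] at h4
  have h5 : orient v z z' = 0 :=
    (mul_eq_zero.1 (by linarith : σ * orient v z z' = 0)).resolve_left hσ
  have h6 := det2_smul_eq (q - v) (z - v) (z' - v)
  have h7 : det2 (z' - v) (z - v) = 0 := by rw [det2_swap]; exact neg_eq_zero.2 h5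
  rw [h7, zero_smul, zero_add] at h6
  set D := σ * orient v q z
  set D' := σ * orient v q z'
  have h8 : D • (z' - v) = D' • (z - v) := by
    have := congrArg (fun p => σ • p) h6
    simp only [smul_smul] at this
    exact this
  have hpos : 0 < D + D' := by positivity
  -- By `h8` this point also equals `(D' v + D z') / (D + D')`, so it lies on both edges.
  have hm : (D / (D + D')) • v + (D' / (D + D')) • z ∈ openHull {v, z} :=
    (mem_openHull_pair hvz).2 ⟨_, _, by positivity, by positivity, by field_simp, rfl⟩
  have hm' : (D / (D + D')) • v + (D' / (D + D')) • z ∈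
      convexHull ℝ (({v, z'} : Finset Plane) : Set Plane) := by
    rw [Finset.coe_pair, convexHull_pair]
    refine ⟨D' / (D + D'), D / (D + D'), by positivity, by positivity, by field_simp; ring, ?_⟩
    have h9 : D • z' = D' • (z - v) + D • v := by rw [← h8]; module
    have : ∀ r : ℝ, ∀ p : Plane, (r / (D + D')) • p = (D + D')⁻¹ • (r • p) := fun r p => by
      rw [smul_smul, div_eq_inv_mul]
    simp only [this, ← smul_add]
    rw [h9]
    module
  have := subset_of_mem_openHull hE hE' hm hm' (show z ∈ _ by simp)
  simpa [hvz.symm] using this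

theorem convex_orient_le (v q : Plane) (σ : ℝ) : Convex ℝ {p | σ * orient v q p ≤ 0} := by
  have : IsLinearMap ℝ fun p : Plane => σ * det2 (q - v) p :=
    ⟨fun a b => by rw [det2_add_right]; ring, fun r a => by rw [det2_smul_right, smul_eq_mul]; ring⟩
  convert! convex_halfSpace_le this (σ * det2 (q - v) v) using 1
  ext p
  have h : orient v q p = det2 (q - v) p - det2 (q - v) v := by simp [orient, det2]; ring
  simp only [Set.mem_ofPred_eq, h, mul_sub, sub_nonpos]

/-- A short walk from `v` towards an interior point `q'` on the chosen side of the line `v q` stays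
in a face having `v` as a vertex. That face cannot have all its vertices in the opposite closed
half-plane. -/
theorem exists_edge_on_side (hT : T.faces.Finite) (hP : T.space = P) (hconv : Convex ℝ P)
    {v q : Plane} (hv : {v} ∈ T.faces) (hvi : v ∉ interior P) (hq : q ∈ interior P) {σ : ℝ}
    (hσ : σ ≠ 0) : ∃ z, {v, z} ∈ T.faces ∧ 0 < σ * orient v q z := by
  have hvP : v ∈ P := mem_of_face hP hv (by simp)
  have hvq : v ≠ q := fun h => hvi (h ▸ hq)
  obtain ⟨d, hd⟩ := exists_orient_pos hvq
  obtain ⟨δ, hδ, h0⟩ := (((tendsto_add_smul q (σ • d)).eventually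
    (isOpen_interior.mem_nhds hq)).and self_mem_nhdsWithin).exists
  have h0 : 0 < δ := h0
  set q' := q + δ • σ • d
  have hq' : 0 < σ * orient v q q' := by
    have : σ * orient v q q' = δ * σ ^ 2 * det2 (q - v) d := by
      simp [q', orient, det2]; ring
    rw [this]
    positivity
  have hlt : ∀ᶠ ε : ℝ in 𝓝[>] 0, ε < 1 := nhdsWithin_le_nhds (gt_mem_nhds one_pos)
  obtain ⟨ε, ⟨hstar, hε1⟩, hε⟩ := ((((tendsto_add_smul v (q' - v)).eventually
    (eventually_mem_convexHull_face hT v)).and hlt).and self_mem_nhdsWithin).exists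
  have hε : 0 < ε := hε
  have hp : v + ε • (q' - v) ∈ T.space := by
    rw [hP]
    exact hconv.add_smul_sub_mem hvP (interior_subset hδ) ⟨hε.le, hε1.le⟩
  obtain ⟨t, ht, hpt⟩ := SimplicialComplex.mem_space_iff.1 hp
  have hvt : v ∈ t := (SimplicialComplex.vertex_mem_convexHull_iff hv ht).1 (hstar t ht hpt)
  by_contra! hcon
  have hsub : (t : Set Plane) ⊆ {p | σ * orient v q p ≤ 0} := fun z hz =>
    hcon z (T.down_closed ht (by
      intro w hw
      simp only [Finset.mem_insert, Finset.mem_singleton] at hw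
      rcases hw with rfl | rfl
      exacts [hvt, hz]) (by simp))
  have := convexHull_min hsub (convex_orient_le v q σ) hpt
  have h2 : σ * orient v q (v + ε • (q' - v)) = ε * (σ * orient v q q') := by
    simp [orient, det2]; ring
  rw [Set.mem_ofPred_eq, h2] at this
  nlinarith [mul_pos hε hq']

/-- Among the edges at `v` on the chosen side, the one making the largest angle with the ray from
`v` to `q` is on the boundary: otherwise the triangle beyond it supplies an edge turned further. -/
theorem exists_boundary_edge (hT : T.faces.Finite) (hP : T.space = P) (hconv : Convex ℝ P)
    (hcl : P ⊆ closure (interior P)) {v q : Plane} (hv : {v} ∈ T.faces) (hvi : v ∉ interior P)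
    (hq : q ∈ interior P) {σ : ℝ} (hσ : σ = 1 ∨ σ = -1) :
    ∃ z, s(v, z) ∈ bdE T P ∧ 0 < σ * orient v q z := by
  have hσ0 : σ ≠ 0 := by rcases hσ with rfl | rfl <;> norm_num
  have hvq : v ≠ q := fun h => hvi (h ▸ hq)
  have hfin : {z | {v, z} ∈ T.faces ∧ 0 < σ * orient v q z}.Finite := by
    refine (hT.biUnion fun t _ => t.finite_toSet).subset fun z hz => ?_
    exact Set.mem_biUnion hz.1 (by simp)
  obtain ⟨z₀, hz₀⟩ := exists_edge_on_side hT hP hconv hv hvi hq hσ0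
  let dot : Plane → ℝ := fun p => (q 0 - v 0) * (p 0 - v 0) + (q 1 - v 1) * (p 1 - v 1)
  -- The quotient is the cotangent of the angle at `v` between `q` and `p`, so minimizing it
  -- maximizes the angle.
  obtain ⟨z, hz, hmin⟩ := hfin.toFinset.exists_min_image
    (fun p => dot p / (σ * orient v q p)) ⟨z₀, by simpa using hz₀⟩
  simp only [Set.Finite.mem_toFinset, Set.mem_ofPred_eq] at hz hmin
  obtain ⟨hE, hoz⟩ := hz
  have hvz : v ≠ z := by
    rintro rfl
    rw [orient_left_self, mul_zero] at hoz
    exact lt_irrefl _ hoz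
  refine ⟨z, mem_bdE.2 ⟨⟨hvz, hE⟩, fun m hm => ?_⟩, hoz⟩
  rw [← openHull_pair hvz] at hm
  refine ⟨subset_closure (openHull_subset_of_face hP hE hm), fun hmi => ?_⟩
  obtain ⟨w, hw, ho⟩ : ∃ w, {v, z, w} ∈ T.faces ∧ 0 < σ * orient v z w := by
    rcases hσ with rfl | rfl
    · simpa using exists_apex_of_mem_interior hT hP hvz hE hm hmi
    · simpa using exists_apex_neg_of_mem_interior hT hP hvz hE hm hmi
  have hvw : {v, w} ∈ T.faces := T.down_closed hw (by intro x; simp; tauto) (by simp)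
  by_cases hside : 0 < σ * orient v q w
  · have h := hmin w ⟨hvw, hside⟩
    rw [div_le_div_iff₀ hoz hside] at h
    have hid : dot z * (σ * orient v q w) - dot w * (σ * orient v q z) =
        ((q 0 - v 0) ^ 2 + (q 1 - v 1) ^ 2) * (σ * orient v z w) := by
      simp [dot, orient, det2]; ring
    have hnn : 0 < (q 0 - v 0) ^ 2 + (q 1 - v 1) ^ 2 := by
      by_contra! hle
      have a0 : q 0 - v 0 = 0 := by nlinarith [sq_nonneg (q 0 - v 0), sq_nonneg (q 1 - v 1)]
      have a1 : q 1 - v 1 = 0 := by nlinarith [sq_nonneg (q 0 - v 0), sq_nonneg (q 1 - v 1)]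
      exact hvq (funext fun i => by fin_cases i <;> simp <;> linarith)
    nlinarith [mul_pos hnn ho]
  -- Here the turn from `q` through `z` to `w` amounts to at least a half-turn, which the supporting
  -- line at `v` excludes.
  · obtain ⟨f, hf, hfi⟩ := exists_support hconv hcl hvi
    have h3 := congrArg f (det2_smul_eq (z - v) (w - v) (q - v))
    simp only [map_smul, map_add, map_sub, smul_eq_mul] at h3
    have e1 := hfi q hq
    have e2 := hf z (mem_of_face hP hE (by simp))
    have e3 := hf w (mem_of_face hP hvw (by simp))
    have h4 : σ * orient v z w * (f q - f v) =
        σ * orient v q w * (f z - f v) - σ * orient v q z * (f w - f v) := by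
      rw [← neg_neg (orient v q z), ← orient_swap_right v q z]
      simp only [orient]
      linear_combination σ * h3
    have h5 : 0 ≤ σ * orient v q w * (f z - f v) :=
      mul_nonneg_of_nonpos_of_nonpos (not_lt.1 hside) (by linarith)
    nlinarith

theorem card_bdE_of_mem_frontier (hT : T.faces.Finite) (hP : T.space = P) (hconv : Convex ℝ P)
    (hcl : P ⊆ closure (interior P)) (hne : (interior P).Nonempty) {v : Plane}
    (hv : {v} ∈ T.faces) (hvf : v ∈ frontier P) : {e ∈ bdE T P | v ∈ e}.ncard = 2 := by
  obtain ⟨q, hq⟩ := hne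
  obtain ⟨z, hz, ho⟩ := exists_boundary_edge hT hP hconv hcl hv hvf.2 hq (Or.inl rfl)
  obtain ⟨z', hz', ho'⟩ := exists_boundary_edge hT hP hconv hcl hv hvf.2 hq (Or.inr rfl)
  rw [Set.ncard_eq_two]
  refine ⟨s(v, z), s(v, z'), ?_, ?_⟩
  · intro h
    rw [Sym2.congr_right] at h
    subst h
    linarith
  · ext e
    simp only [Set.mem_ofPred_eq, Set.mem_insert_iff, Set.mem_singleton_iff]
    constructor
    · rintro ⟨he, w, rfl⟩
      obtain ⟨⟨hvw, hE⟩, hfr⟩ := mem_bdE.1 he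
      have hn := orient_ne_zero_of_boundary_edge hconv hcl hvw (mem_of_face hP hE (by simp))
        (mem_of_face hP hE (by simp)) hq hfr
      rcases hn.lt_or_gt with h | h
      · rw [boundary_edge_unique hP hconv hcl hq he hz' (by norm_num) (by linarith) ho']
        exact Or.inr rfl
      · rw [boundary_edge_unique hP hconv hcl hq he hz one_ne_zero (by linarith) ho]
        exact Or.inl rfl
    · rintro (rfl | rfl)
      · exact ⟨hz, Sym2.mem_mk_left _ _⟩
      · exact ⟨hz', Sym2.mem_mk_left _ _⟩

/-! ### Tensor identities and power sums. -/

theorem sq_apply (x : Plane) (u v : Fin 2) : sq x u v = x u * x v := rfl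

/-- `y² + z²` for an unordered pair `{y, z}`. -/
noncomputable def endSq : Sym2 Plane → Matrix (Fin 2) (Fin 2) ℝ :=
  Sym2.lift ⟨fun y z => sq y + sq z, fun _ _ => add_comm _ _⟩

theorem endSq_mk (y z : Plane) : endSq s(y, z) = sq y + sq z := rfl

theorem sumSq_mk (y z : Plane) : sumSq s(y, z) = sq (y + z) := rfl

theorem diffSq_eq (e : Sym2 Plane) : diffSq e = (2 : ℝ) • endSq e - sumSq e := by
  induction e with
  | _ y z =>
    change sq (y - z) = (2 : ℝ) • (sq y + sq z) - sq (y + z)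
    ext u v
    simp [sq_apply]
    ring

/-- Primed and unprimed letters stand for the two coordinates in a matrix entry. The parameter `r`
is kept independent of the range `k` so that induction applies; the use is at `r = k`. -/
theorem sum_range_mul_two (k : ℕ) (r a b a' b' : ℝ) :
    ∑ i ∈ Finset.range k, ((i + 1) * a + (r - i) * b) * ((i + 1) * a' + (r - i) * b') =
      k * (k + 1) * (2 * k + 1) / 6 * (a * a')
      + (r * k * (k + 1) / 2 - (k - 1) * k * (k + 1) / 3) * (a * b' + a' * b)
      + (k * r ^ 2 - r * k * (k - 1) + (k - 1) * k * (2 * k - 1) / 6) * (b * b') := by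
  induction k with
  | zero => simp
  | succ k ih => rw [Finset.sum_range_succ, ih]; push_cast; ring

theorem sum_range_mul_three_inner (k : ℕ) (r s a b c a' b' c' : ℝ) :
    ∑ q ∈ Finset.range k, ((q + 1) * a + (r - q) * b + s * c) *
        ((q + 1) * a' + (r - q) * b' + s * c') =
      k * (k + 1) * (2 * k + 1) / 6 * (a * a')
      + (r * k * (k + 1) / 2 - (k - 1) * k * (k + 1) / 3) * (a * b' + a' * b)
      + (k * r ^ 2 - r * k * (k - 1) + (k - 1) * k * (2 * k - 1) / 6) * (b * b')
      + k * s ^ 2 * (c * c') + k * (k + 1) / 2 * s * (a * c' + a' * c)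
      + (k * r - k * (k - 1) / 2) * s * (b * c' + b' * c) := by
  induction k with
  | zero => simp
  | succ k ih => rw [Finset.sum_range_succ, ih]; push_cast; ring

theorem sum_range_mul_three (k : ℕ) (r a b c a' b' c' : ℝ) :
    ∑ p ∈ Finset.range k, ∑ q ∈ Finset.range p, ((q + 1) * a + (p - q) * b + (r - p) * c) *
        ((q + 1) * a' + (p - q) * b' + (r - p) * c') =
      (k - 1) * k ^ 2 * (k + 1) / 12 * (a * a' + b * b')
      + (k - 1) * k * (k + 1) * (k + 2) / 24 * (a * b' + a' * b)
      + (r ^ 2 * k * (k - 1) / 2 - r * (k - 1) * k * (2 * k - 1) / 3 + (k * (k - 1) / 2) ^ 2)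
        * (c * c')
      + (r * (k - 1) * k * (k + 1) / 6 - (k * (k - 1) / 2) ^ 2 / 2 - (k - 1) * k * (2 * k - 1) / 12)
        * (a * c' + a' * c + b * c' + b' * c) := by
  induction k with
  | zero => simp
  | succ k ih =>
    rw [Finset.sum_range_succ, ih, sum_range_mul_three_inner]; push_cast; ring

/-! ### Lattice points in dilated faces. -/

/-- The sum of `x²` over the lattice points in the relative interior of `n` times a face. -/
noncomputable def faceSum (n : ℕ) (s : Finset Plane) : Matrix (Fin 2) (Fin 2) ℝ :=
  ∑ᶠ x ∈ ((n : ℝ) • openHull s) ∩ lattice, sq x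

theorem faceSum_singleton {v : Plane} (hv : v ∈ lattice) (n : ℕ) :
    faceSum n {v} = (n : ℝ) ^ 2 • sq v := by
  have h : ((n : ℝ) • openHull {v}) ∩ lattice = {(n : ℝ) • v} := by
    have : openHull {v} = {v} := Set.ext fun x => mem_openHull_singleton
    rw [this, Set.smul_set_singleton, Set.inter_eq_left, Set.singleton_subset_iff]
    exact lattice_nsmul hv n
  rw [faceSum, h, finsum_mem_singleton]
  ext u w
  simp [sq_apply]
  ring

theorem mem_smul_openHull_pair {y z x : Plane} (h : y ≠ z) {r : ℝ} (hr : 0 < r) :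
    x ∈ r • openHull {y, z} ↔ ∃ i j : ℝ, 0 < i ∧ 0 < j ∧ i + j = r ∧ i • y + j • z = x := by
  rw [Set.mem_smul_set]
  constructor
  · rintro ⟨p, hp, rfl⟩
    obtain ⟨α, β, hα, hβ, hs, rfl⟩ := (mem_openHull_pair h).1 hp
    exact ⟨r * α, r * β, by positivity, by positivity, by rw [← mul_add, hs, mul_one], by module⟩
  · rintro ⟨i, j, hi, hj, hs, rfl⟩
    refine ⟨(i / r) • y + (j / r) • z, (mem_openHull_pair h).2
      ⟨_, _, by positivity, by positivity, by rw [← add_div, hs, div_self hr.ne'], rfl⟩, ?_⟩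
    rw [smul_add, smul_smul, smul_smul, mul_div_cancel₀ _ hr.ne', mul_div_cancel₀ _ hr.ne']

theorem mem_smul_openHull_triple {a b c x : Plane} (hab : a ≠ b) (hac : a ≠ c) (hbc : b ≠ c)
    {r : ℝ} (hr : 0 < r) :
    x ∈ r • openHull {a, b, c} ↔
      ∃ i j k : ℝ, 0 < i ∧ 0 < j ∧ 0 < k ∧ i + j + k = r ∧ i • a + j • b + k • c = x := by
  rw [Set.mem_smul_set]
  constructor
  · rintro ⟨p, hp, rfl⟩
    obtain ⟨α, β, γ, hα, hβ, hγ, hs, rfl⟩ := (mem_openHull_triple hab hac hbc).1 hp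
    exact ⟨r * α, r * β, r * γ, by positivity, by positivity, by positivity,
      by rw [← mul_add, ← mul_add, hs, mul_one], by module⟩
  · rintro ⟨i, j, k, hi, hj, hk, hs, rfl⟩
    refine ⟨(i / r) • a + (j / r) • b + (k / r) • c, (mem_openHull_triple hab hac hbc).2
      ⟨_, _, _, by positivity, by positivity, by positivity,
        by rw [← add_div, ← add_div, hs, div_self hr.ne'], rfl⟩, ?_⟩
    rw [smul_add, smul_add, smul_smul, smul_smul, smul_smul, mul_div_cancel₀ _ hr.ne',
      mul_div_cancel₀ _ hr.ne', mul_div_cancel₀ _ hr.ne']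

theorem exists_nat_succ_of_int {r : ℝ} (hr : 0 < r) (h : ∃ m : ℤ, r = m) :
    ∃ k : ℕ, r = k + 1 := by
  obtain ⟨m, rfl⟩ := h
  have hm : 0 < m := by exact_mod_cast hr
  refine ⟨(m - 1).toNat, ?_⟩
  have : (((m - 1).toNat : ℤ) : ℝ) = ((m - 1 : ℤ) : ℝ) := by
    rw [Int.toNat_of_nonneg (by omega)]
  push_cast at this
  linarith

/-- The third vertex `w` serves only to make the edge primitive, so that the weights are integers.
Positive weights of sum `m + 1` are `i + 1` and `m - i` with `i < m`. -/
theorem smul_openHull_pair_inter_lattice {y z w : Plane} (hy : y ∈ lattice) (hz : z ∈ lattice)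
    (hw : w ∈ lattice) (ho : |orient y z w| = 1) (m : ℕ) :
    (((m + 1 : ℕ) : ℝ) • openHull {y, z}) ∩ lattice =
      ((Finset.range m).image fun i : ℕ => ((i : ℝ) + 1) • y + ((m : ℝ) - i) • z : Finset Plane) := by
  have hyz : y ≠ z := (ne_of_orient_ne_zero (abs_pos.1 (by rw [ho]; exact one_pos))).1
  ext x
  rw [Set.mem_inter_iff, mem_smul_openHull_pair hyz (by positivity)]
  simp only [Finset.coe_image, Finset.coe_range, Set.mem_image, Set.mem_Iio]
  constructor
  · rintro ⟨⟨i, j, hi, hj, hs, hx⟩, hl⟩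
    obtain ⟨k, rfl⟩ := exists_nat_succ_of_int hi (exists_int_coeff (i := j) (k := 0) hz hw hl
      (by rw [orient_swap, abs_neg, ho]) (by rw [← hs]; ring)
      (by rw [← hx, zero_smul, add_zero, add_comm]))
    push_cast at hs
    refine ⟨k, ?_, ?_⟩
    · have : (k : ℝ) < m := by linarith
      exact_mod_cast this
    · rw [← hx, show j = m - k by linarith]
  · rintro ⟨k, hk, rfl⟩
    have hk' : (k : ℝ) < m := by exact_mod_cast hk
    refine ⟨⟨_, _, by positivity, by linarith, by push_cast; ring, rfl⟩, ?_⟩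
    convert! lattice_add (lattice_nsmul hy (k + 1)) (lattice_nsmul hz (m - k)) using 1
    rw [Nat.cast_sub hk.le]
    push_cast
    rfl

theorem smul_openHull_triple_inter_lattice {a b c : Plane} (ha : a ∈ lattice) (hb : b ∈ lattice)
    (hc : c ∈ lattice) (ho : |orient a b c| = 1) (m : ℕ) :
    (((m + 1 : ℕ) : ℝ) • openHull {a, b, c}) ∩ lattice =
      (((Finset.range m).sigma fun p => Finset.range p).image fun x : (_ : ℕ) × ℕ =>
        ((x.2 : ℝ) + 1) • a + ((x.1 : ℝ) - x.2) • b + ((m : ℝ) - x.1) • c : Finset Plane) := by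
  obtain ⟨hab, hac, hbc⟩ := ne_of_orient_ne_zero (abs_pos.1 (by rw [ho]; exact one_pos))
  ext x
  rw [Set.mem_inter_iff, mem_smul_openHull_triple hab hac hbc (by positivity)]
  simp only [Finset.coe_image, Set.mem_image, Finset.mem_coe, Finset.mem_sigma, Finset.mem_range,
    Sigma.exists]
  constructor
  · rintro ⟨⟨i, j, k, hi, hj, hk, hs, hx⟩, hl⟩
    obtain ⟨q, rfl⟩ := exists_nat_succ_of_int hi (exists_int_coeff (i := j) (k := k) hb hc hl
      (by rw [orient_swap, abs_neg, ho]) (by rw [← hs]; ring) (by rw [← hx]; abel))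
    obtain ⟨l, rfl⟩ := exists_nat_succ_of_int hk (exists_int_coeff (i := (q : ℝ) + 1) (k := j)
      ha hb hl (by rw [orient_swap_right, abs_neg, ho]) (by rw [← hs]; ring) (by rw [← hx]; abel))
    push_cast at hs
    have h1 : q + l + 1 < m := by
      have : (q : ℝ) + l + 1 < m := by linarith
      exact_mod_cast this
    -- The weights are `q + 1`, `p - q`, `m - p` with `q < p < m`; thus `p` is determined by the
    -- weight `l + 1` of `c`.
    refine ⟨m - (l + 1), q, ⟨by omega, by omega⟩, ?_⟩
    rw [← hx, Nat.cast_sub (by omega : l + 1 ≤ m)]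
    congr 3 <;> push_cast <;> linarith
  · rintro ⟨p, q, ⟨hp, hq⟩, rfl⟩
    have hp' : (p : ℝ) < m := by exact_mod_cast hp
    have hq' : (q : ℝ) < p := by exact_mod_cast hq
    refine ⟨⟨_, _, _, by positivity, by linarith, by linarith, by push_cast; ring, rfl⟩, ?_⟩
    convert! lattice_add (lattice_add (lattice_nsmul ha (q + 1)) (lattice_nsmul hb (p - q)))
      (lattice_nsmul hc (m - p)) using 1
    rw [Nat.cast_sub hq.le, Nat.cast_sub hp.le]
    push_cast
    rfl

theorem faceSum_pair {y z w : Plane} (hy : y ∈ lattice) (hz : z ∈ lattice)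
    (hw : w ∈ lattice) (ho : |orient y z w| = 1) (m : ℕ) :
    faceSum (m + 1) {y, z} = ((m - 1) * m * (m + 1) / 6 : ℝ) • endSq s(y, z)
      + (m * (m + 1) * (m + 2) / 6 : ℝ) • sumSq s(y, z) := by
  rw [faceSum, smul_openHull_pair_inter_lattice hy hz hw ho, finsum_mem_coe_finset,
    Finset.sum_image]
  · ext u v
    simp only [Matrix.sum_apply, sq_apply, endSq_mk, sumSq_mk, Matrix.add_apply, Matrix.smul_apply,
      Pi.add_apply, Pi.smul_apply, smul_eq_mul]
    rw [sum_range_mul_two]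
    ring
  · intro i _ j _ hij
    have hyz : y ≠ z := (ne_of_orient_ne_zero (abs_pos.1 (by rw [ho]; exact one_pos))).1
    have h1 : ((i : ℝ) - j) • (y - z) = 0 := by
      have hij : ((i : ℝ) + 1) • y + ((m : ℝ) - i) • z = ((j : ℝ) + 1) • y + ((m : ℝ) - j) • z := hij
      have h2 := sub_eq_zero.2 hij
      rw [← h2]
      module
    have := (smul_eq_zero.1 h1).resolve_right (sub_ne_zero.2 hyz)
    exact_mod_cast sub_eq_zero.1 this

/-- Each vertex lies on two sides, so the `endSq` terms add up to twice the sum of the vertex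
squares. Subtracting them from the `sumSq` terms isolates the cross terms, which have equal
coefficients by symmetry. -/
theorem faceSum_triple {a b c : Plane} (ha : a ∈ lattice) (hb : b ∈ lattice)
    (hc : c ∈ lattice) (ho : |orient a b c| = 1) (m : ℕ) :
    faceSum (m + 1) {a, b, c} =
      (-((m - 1) * m * (m + 1) / 12) : ℝ) • (endSq s(a, b) + endSq s(a, c) + endSq s(b, c))
      + ((m - 1) * m * (m + 1) * (m + 2) / 24 : ℝ) •
        (sumSq s(a, b) + sumSq s(a, c) + sumSq s(b, c)) := by
  rw [faceSum, smul_openHull_triple_inter_lattice ha hb hc ho, finsum_mem_coe_finset,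
    Finset.sum_image, Finset.sum_sigma]
  · ext u v
    simp only [Matrix.sum_apply, sq_apply, endSq_mk, sumSq_mk, Matrix.add_apply, Matrix.smul_apply,
      Pi.add_apply, Pi.smul_apply, smul_eq_mul]
    rw [sum_range_mul_three]
    ring
  · have hne : orient a b c ≠ 0 := abs_pos.1 (by rw [ho]; exact one_pos)
    rintro ⟨p, q⟩ - ⟨p', q'⟩ - h
    have h : ((q : ℝ) + 1) • a + ((p : ℝ) - q) • b + ((m : ℝ) - p) • c =
      ((q' : ℝ) + 1) • a + ((p' : ℝ) - q') • b + ((m : ℝ) - p') • c := h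
    have hs : ∀ x y : ℝ, (y + 1) + (x - y) + (m - x) = m + 1 := fun x y => by ring
    have e1 := orient_affine_comb a b c (hs p q) _ rfl
    rw [h, orient_affine_comb a b c (hs p' q') _ rfl] at e1
    have e2 := mul_right_cancel₀ hne e1
    have e3 : ((q : ℝ) - q') • (a - c) = 0 := by
      have h2 := sub_eq_zero.2 h
      rw [← h2, show (p : ℝ) = p' - q' + q by linarith]
      module
    have e4 := (smul_eq_zero.1 e3).resolve_right (sub_ne_zero.2 (ne_of_orient_ne_zero hne).2.1)
    have e5 : q = q' := by exact_mod_cast sub_eq_zero.1 e4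
    subst e5
    have e6 : p = p' := by
      have : (p : ℝ) = p' := by linarith
      exact_mod_cast this
    rw [e6]

/-! ### Basic facts on lattice polygons and their triangulations -/

theorem IsLatticePolygon.convex (hP : IsLatticePolygon P) : Convex ℝ P := by
  obtain ⟨⟨S, -, rfl⟩, -⟩ := hP
  exact convex_convexHull ℝ _

theorem IsLatticePolygon.isCompact (hP : IsLatticePolygon P) : IsCompact P := by
  obtain ⟨⟨S, -, rfl⟩, -⟩ := hP
  exact S.finite_toSet.isCompact_convexHull ℝ

theorem IsLatticePolygon.subset_closure_interior (hP : IsLatticePolygon P) :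
    P ⊆ closure (interior P) := by
  rw [hP.convex.closure_interior_eq_closure_of_nonempty_interior hP.2]
  exact subset_closure

theorem IsLatticePolygon.finite_V (hP : IsLatticePolygon P) : (V P).Finite :=
  finite_lattice_inter hP.isCompact.isBounded

theorem IsLatticePolygon.finite_bdV (hP : IsLatticePolygon P) :
    (bdV P).Finite :=
  hP.finite_V.subset fun _ h => ⟨hP.isCompact.isClosed.frontier_subset h.1, h.2⟩

theorem IsLatticePolygon.finite_intV (hP : IsLatticePolygon P) :
    (intV P).Finite :=
  hP.finite_V.subset fun _ h => ⟨interior_subset h.1, h.2⟩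

theorem IsLatticePolygon.sum_V (hP : IsLatticePolygon P)
    {M : Type*} [AddCommMonoid M] (g : Plane → M) :
    ∑ v ∈ hP.finite_V.toFinset, g v =
      ∑ v ∈ hP.finite_bdV.toFinset, g v + ∑ v ∈ hP.finite_intV.toFinset, g v := by
  rw [← Finset.sum_union]
  · congr 1
    ext v
    simp only [Set.Finite.mem_toFinset, Finset.mem_union, V, bdV, intV, Set.mem_inter_iff,
      hP.isCompact.isClosed.frontier_eq, Set.mem_sdiff]
    have := @interior_subset _ _ P v
    tauto
  · rw [Finset.disjoint_left]
    intro v hv hv'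
    rw [Set.Finite.mem_toFinset] at hv hv'
    exact hv.1.2 hv'.1

namespace IsUnimodularTriangulation

theorem mem_lattice (hT : IsUnimodularTriangulation T P) {s : Finset Plane} (hs : s ∈ T.faces)
    {v : Plane} (hv : v ∈ s) : v ∈ lattice :=
  hT.vertices_subset (T.down_closed hs (Finset.singleton_subset_iff.2 hv) (by simp))

theorem finite_faces (hT : IsUnimodularTriangulation T P) (hP : IsLatticePolygon P) :
    T.faces.Finite := by
  refine (hP.finite_V.toFinset.powerset.finite_toSet).subset fun s hs => ?_
  rw [Finset.mem_coe, Finset.mem_powerset]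
  intro v hv
  rw [Set.Finite.mem_toFinset]
  exact ⟨mem_of_face hT.space_eq hs hv, hT.mem_lattice hs hv⟩

theorem abs_orient (hT : IsUnimodularTriangulation T P) {a b c : Plane}
    (hs : {a, b, c} ∈ T.faces) (ho : orient a b c ≠ 0) : |orient a b c| = 1 := by
  refine abs_orient_eq_one_of_volume ?_
  have := hT.area_eq _ hs (card_triple ho)
  rwa [Finset.coe_insert, Finset.coe_pair] at this

theorem exists_unimodular_apex (hT : IsUnimodularTriangulation T P) (hP : IsLatticePolygon P)
    {y z : Plane} (hyz : y ≠ z) (hE : {y, z} ∈ T.faces) :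
    ∃ w, {y, z, w} ∈ T.faces ∧ |orient y z w| = 1 := by
  obtain ⟨w, hw, ho⟩ := exists_apex (hT.finite_faces hP) hT.space_eq hP.subset_closure_interior
    hyz hE
  exact ⟨w, hw, hT.abs_orient hw ho⟩

theorem face_cases {s : Finset Plane} (hs : s ∈ T.faces) :
    s.card = 1 ∨ s.card = 2 ∨ s.card = 3 := by
  have h1 := card_face_le hs
  have h2 := (SimplicialComplex.nonempty_of_mem_faces hs).card_pos
  omega

theorem openHull_inter_lattice_eq_empty (hT : IsUnimodularTriangulation T P)
    (hP : IsLatticePolygon P) {s : Finset Plane} (hs : s ∈ T.faces) (h1 : s.card ≠ 1) :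
    openHull s ∩ lattice = ∅ := by
  -- Dilation by `1` is the case `m = 0` of the parametrizations above, where the index set is
  -- empty.
  have hone : openHull s = ((0 + 1 : ℕ) : ℝ) • openHull s := by simp
  rw [hone]
  rcases face_cases hs with h | h | h
  · exact (h1 h).elim
  · obtain ⟨y, z, hyz, rfl⟩ := Finset.card_eq_two.1 h
    obtain ⟨w, hw, ho⟩ := hT.exists_unimodular_apex hP hyz hs
    rw [smul_openHull_pair_inter_lattice (hT.mem_lattice hw (by simp)) (hT.mem_lattice hw (by simp))
      (hT.mem_lattice hw (by simp)) ho]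
    simp
  · obtain ⟨a, b, c, hab, hac, hbc, rfl⟩ := Finset.card_eq_three.1 h
    rw [smul_openHull_triple_inter_lattice (hT.mem_lattice hs (by simp))
      (hT.mem_lattice hs (by simp)) (hT.mem_lattice hs (by simp))
      (hT.abs_orient hs (orient_ne_zero hs hab hac hbc))]
    simp

/-- The lattice points of the polygon are the vertices of the triangulation. -/
theorem singleton_mem_faces_iff (hT : IsUnimodularTriangulation T P) (hP : IsLatticePolygon P)
    {v : Plane} : {v} ∈ T.faces ↔ v ∈ V P := by
  constructor
  · intro h
    exact ⟨mem_of_face hT.space_eq h (by simp), hT.vertices_subset h⟩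
  · rintro ⟨hv, hl⟩
    rw [← hT.space_eq] at hv
    obtain ⟨s, hs, hvs⟩ := exists_face_openHull hv
    by_cases h1 : s.card = 1
    · obtain ⟨a, rfl⟩ := Finset.card_eq_one.1 h1
      rwa [mem_openHull_singleton.1 hvs]
    · have : v ∈ openHull s ∩ lattice := ⟨hvs, hl⟩
      rw [hT.openHull_inter_lattice_eq_empty hP hs h1] at this
      exact this.elim

theorem finite_E (hT : IsUnimodularTriangulation T P) (hP : IsLatticePolygon P) :
    (E T).Finite := by
  refine (hP.finite_V.toFinset.sym2.finite_toSet).subset fun e he => ?_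
  induction e with
  | _ y z =>
    have hE := (mem_E.1 he).2
    rw [Finset.mem_coe, Finset.mk_mem_sym2_iff, Set.Finite.mem_toFinset, Set.Finite.mem_toFinset]
    exact ⟨⟨mem_of_face hT.space_eq hE (by simp), hT.mem_lattice hE (by simp)⟩,
      ⟨mem_of_face hT.space_eq hE (by simp), hT.mem_lattice hE (by simp)⟩⟩

/-! ### Sums over the faces -/

/-- The relative interiors of the faces partition `P`, and scaling by `n ≠ 0` is injective, so their
dilates stay disjoint. -/
theorem momentMatrix_smul (hT : IsUnimodularTriangulation T P) (hP : IsLatticePolygon P)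
    {n : ℕ} (hn : n ≠ 0) :
    momentMatrix ((n : ℝ) • P) = ∑ s ∈ (hT.finite_faces hP).toFinset, faceSum n s := by
  have hn' : (n : ℝ) ≠ 0 := by exact_mod_cast hn
  have hfin : (((n : ℝ) • P) ∩ lattice).Finite :=
    finite_lattice_inter (hP.isCompact.smul (n : ℝ)).isBounded
  have hset : ((n : ℝ) • P) ∩ lattice = ⋃ s ∈ T.faces, ((n : ℝ) • openHull s) ∩ lattice := by
    ext x
    simp only [Set.mem_inter_iff, Set.mem_iUnion, exists_prop]
    constructor
    · rintro ⟨⟨p, hp, rfl⟩, hl⟩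
      rw [← hT.space_eq] at hp
      obtain ⟨s, hs, hps⟩ := exists_face_openHull hp
      exact ⟨s, hs, ⟨p, hps, rfl⟩, hl⟩
    · rintro ⟨s, hs, ⟨p, hp, rfl⟩, hl⟩
      exact ⟨⟨p, openHull_subset_of_face hT.space_eq hs hp, rfl⟩, hl⟩
  rw [momentMatrix, hset, finsum_mem_biUnion, finsum_mem_eq_finite_toFinset_sum _
    (hT.finite_faces hP)]
  · rfl
  · intro s hs t ht hst
    refine Set.disjoint_left.2 ?_
    rintro _ ⟨⟨p, hp, rfl⟩, -⟩ ⟨⟨q, hq, hqp⟩, -⟩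
    obtain rfl : q = p := smul_right_injective Plane hn' hqp
    exact hst (eq_of_mem_openHull hs ht hp hq)
  · exact hT.finite_faces hP
  · intro s hs
    refine hfin.subset ?_
    rw [hset]
    exact Set.subset_biUnion_of_mem (u := fun s => ((n : ℝ) • openHull s) ∩ lattice) hs

theorem sum_faces (hT : IsUnimodularTriangulation T P) (hP : IsLatticePolygon P)
    {M : Type*} [AddCommMonoid M] (f : Finset Plane → M) :
    ∑ s ∈ (hT.finite_faces hP).toFinset, f s = ∑ v ∈ hP.finite_V.toFinset, f {v}
      + ∑ e ∈ (hT.finite_E hP).toFinset, f e.toFinset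
      + ∑ t ∈ triangles (hT.finite_faces hP), f t := by
  set F := (hT.finite_faces hP).toFinset
  have hF : ∀ {s}, s ∈ F ↔ s ∈ T.faces := by simp [F]
  have e1 : ∑ v ∈ hP.finite_V.toFinset, f {v} = ∑ s ∈ F with s.card = 1, f s := by
    refine Finset.sum_nbij (fun v => {v}) ?_ ?_ ?_ fun _ _ => rfl
    · intro v hv
      rw [Set.Finite.mem_toFinset] at hv
      rw [Finset.mem_filter, hF]
      exact ⟨(hT.singleton_mem_faces_iff hP).2 hv, by simp⟩
    · exact Finset.singleton_injective.injOn
    · intro s hs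
      rw [Finset.mem_coe, Finset.mem_filter, hF] at hs
      obtain ⟨v, rfl⟩ := Finset.card_eq_one.1 hs.2
      exact ⟨v, by simpa using (hT.singleton_mem_faces_iff hP).1 hs.1, rfl⟩
  have e2 : ∑ e ∈ (hT.finite_E hP).toFinset, f e.toFinset = ∑ s ∈ F with s.card = 2, f s := by
    refine Finset.sum_nbij Sym2.toFinset ?_ ?_ ?_ fun _ _ => rfl
    · intro e he
      rw [Set.Finite.mem_toFinset] at he
      induction e with
      | _ y z =>
        rw [Finset.mem_filter, hF, Sym2.toFinset_mk_eq]
        exact ⟨(mem_E.1 he).2, Finset.card_pair (mem_E.1 he).1⟩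
    · intro e _ e' _ h
      refine Sym2.ext fun x => ?_
      rw [← Sym2.mem_toFinset, ← Sym2.mem_toFinset, h]
    · intro s hs
      rw [Finset.mem_coe, Finset.mem_filter, hF] at hs
      obtain ⟨y, z, hyz, rfl⟩ := Finset.card_eq_two.1 hs.2
      exact ⟨s(y, z), by simpa using mem_E.2 ⟨hyz, hs.1⟩, Sym2.toFinset_mk_eq⟩
  rw [e1, e2, triangles, ← Finset.sum_filter_add_sum_filter_not F fun s => s.card = 1, add_assoc]
  congr 1
  rw [← Finset.sum_filter_add_sum_filter_not (F.filter _) fun s => s.card = 2,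
    Finset.filter_filter, Finset.filter_filter]
  congr 1 <;> refine Finset.sum_congr (Finset.filter_congr fun s hs => ?_) fun _ _ => rfl
  · omega
  · have := face_cases (hF.1 hs)
    omega

theorem finite_bdE (hT : IsUnimodularTriangulation T P) (hP : IsLatticePolygon P) :
    (bdE T P).Finite := (hT.finite_E hP).subset fun _ h => h.1

theorem finite_intE (hT : IsUnimodularTriangulation T P) (hP : IsLatticePolygon P) :
    (intE T P).Finite := (hT.finite_E hP).subset fun _ h => h.1

theorem sum_E (hT : IsUnimodularTriangulation T P) (hP : IsLatticePolygon P)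
    {M : Type*} [AddCommMonoid M] (g : Sym2 Plane → M) :
    ∑ e ∈ (hT.finite_E hP).toFinset, g e =
      ∑ e ∈ (hT.finite_bdE hP).toFinset, g e + ∑ e ∈ (hT.finite_intE hP).toFinset, g e := by
  classical
  rw [← Finset.sum_union]
  · congr 1
    ext e
    simp only [Set.Finite.mem_toFinset, Finset.mem_union, bdE, intE, Set.mem_ofPred_eq]
    tauto
  · rw [Finset.disjoint_left]
    intro e he he'
    rw [Set.Finite.mem_toFinset] at he he'
    exact he'.2 he.2

theorem sum_triangle_edges (hT : IsUnimodularTriangulation T P) (hP : IsLatticePolygon P)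
    {M : Type*} [AddCommMonoid M] (g : Sym2 Plane → M) {a b c : Plane}
    (hs : {a, b, c} ∈ T.faces) (hab : a ≠ b) (hac : a ≠ c) (hbc : b ≠ c) :
    ∑ e ∈ (hT.finite_E hP).toFinset with e.toFinset ⊆ {a, b, c}, g e =
      g s(a, b) + g s(a, c) + g s(b, c) := by
  have : (hT.finite_E hP).toFinset.filter (fun e => e.toFinset ⊆ {a, b, c}) =
      {s(a, b), s(a, c), s(b, c)} := by
    ext e
    induction e with
    | _ y z =>
      rw [Finset.mem_filter, Set.Finite.mem_toFinset, mem_E, Sym2.toFinset_mk_eq]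
      constructor
      · rintro ⟨⟨hyz, -⟩, hsub⟩
        have hy := hsub (show y ∈ _ by simp)
        have hz := hsub (show z ∈ _ by simp)
        simp only [Finset.mem_insert, Finset.mem_singleton] at hy hz ⊢
        rcases hy with rfl | rfl | rfl <;> rcases hz with rfl | rfl | rfl <;>
          simp_all [Sym2.eq_swap]
      · intro h
        have key : ∀ p q : Plane, p ≠ q → p ∈ ({a, b, c} : Finset Plane) →
            q ∈ ({a, b, c} : Finset Plane) → s(y, z) = s(p, q) →
            (y ≠ z ∧ {y, z} ∈ T.faces) ∧ ({y, z} : Finset Plane) ⊆ {a, b, c} := by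
          intro p q hpq hp hq h
          have hsub : ({y, z} : Finset Plane) ⊆ {a, b, c} := by
            rw [Finset.insert_subset_iff, Finset.singleton_subset_iff]
            rcases Sym2.eq_iff.1 h with ⟨rfl, rfl⟩ | ⟨rfl, rfl⟩
            exacts [⟨hp, hq⟩, ⟨hq, hp⟩]
          refine ⟨⟨?_, T.down_closed hs hsub (by simp)⟩, hsub⟩
          rcases Sym2.eq_iff.1 h with ⟨rfl, rfl⟩ | ⟨rfl, rfl⟩
          exacts [hpq, hpq.symm]
        simp only [Finset.mem_insert, Finset.mem_singleton] at h
        rcases h with h | h | h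
        · exact key a b hab (by simp) (by simp) h
        · exact key a c hac (by simp) (by simp) h
        · exact key b c hbc (by simp) (by simp) h
  rw [this, Finset.sum_insert (by simp [hab, hac, hbc, hab.symm]),
    Finset.sum_pair (by simp [hab, hac, hbc.symm]), add_assoc]

/-- Boundary edges lie in one triangle, the other edges in two. -/
theorem sum_triangles_sum_edges (hT : IsUnimodularTriangulation T P) (hP : IsLatticePolygon P)
    {M : Type*} [AddCommMonoid M] (g : Sym2 Plane → M) :
    ∑ t ∈ triangles (hT.finite_faces hP),
        ∑ e ∈ (hT.finite_E hP).toFinset with e.toFinset ⊆ t, g e =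
      ∑ e ∈ (hT.finite_bdE hP).toFinset, g e
        + 2 • ∑ e ∈ (hT.finite_intE hP).toFinset, g e := by
  -- Double counting: each edge is weighted by the number of triangles containing it.
  rw [Finset.sum_comm' (t' := (hT.finite_E hP).toFinset)
    (s' := fun e => (triangles (hT.finite_faces hP)).filter fun t => e.toFinset ⊆ t)
    (by intro t e; simp only [Finset.mem_filter]; tauto)]
  simp only [Finset.sum_const]
  rw [hT.sum_E hP, Finset.smul_sum]
  congr 1 <;> refine Finset.sum_congr rfl fun e he => ?_ <;> rw [Set.Finite.mem_toFinset] at he <;>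
    induction e with | _ y z => ?_ <;> rw [Sym2.toFinset_mk_eq]
  · rw [card_triangles_of_mem_bdE _ hT.space_eq hP.convex hP.subset_closure_interior hP.2 he,
      one_smul]
  · rw [card_triangles_of_mem_intE _ hT.space_eq he]

/-- Each boundary lattice point lies on two boundary edges. -/
theorem sum_bdE_endSq (hT : IsUnimodularTriangulation T P) (hP : IsLatticePolygon P) :
    ∑ e ∈ (hT.finite_bdE hP).toFinset, endSq e =
      (2 : ℝ) • ∑ v ∈ hP.finite_bdV.toFinset, sq v := by
  have h1 : ∀ e ∈ (hT.finite_bdE hP).toFinset, endSq e = ∑ v ∈ e.toFinset, sq v := by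
    intro e he
    rw [Set.Finite.mem_toFinset] at he
    induction e with
    | _ y z => rw [Sym2.toFinset_mk_eq, Finset.sum_pair (mem_bdE.1 he).1.1, endSq_mk]
  rw [Finset.sum_congr rfl h1, Finset.sum_comm' (t' := hP.finite_bdV.toFinset)
    (s' := fun v => (hT.finite_bdE hP).toFinset.filter fun e => v ∈ e), Finset.smul_sum]
  · refine Finset.sum_congr rfl fun v hv => ?_
    rw [Set.Finite.mem_toFinset] at hv
    have h2 := card_bdE_of_mem_frontier (hT.finite_faces hP) hT.space_eq hP.convex
      hP.subset_closure_interior hP.2 ((hT.singleton_mem_faces_iff hP).2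
        ⟨hP.isCompact.isClosed.frontier_subset hv.1, hv.2⟩) hv.1
    have h3 : {e ∈ bdE T P | v ∈ e} =
        ((hT.finite_bdE hP).toFinset.filter fun e => v ∈ e : Finset (Sym2 Plane)) := by
      ext; simp
    rw [h3, Set.ncard_coe_finset] at h2
    rw [Finset.sum_const, h2, two_smul, two_smul]
  · intro e v
    rw [Finset.mem_filter, Set.Finite.mem_toFinset, Set.Finite.mem_toFinset, Sym2.mem_toFinset]
    refine ⟨fun h => ⟨h, ?_⟩, fun h => h.1⟩
    obtain ⟨he, w, rfl⟩ := h
    obtain ⟨⟨_, hE⟩, hfr⟩ := mem_bdE.1 he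
    refine ⟨?_, hT.mem_lattice hE (by simp)⟩
    -- The frontier is closed, so it contains the endpoints of a boundary edge as well.
    have := closure_minimal hfr isClosed_frontier
    rw [closure_openSegment] at this
    exact this (left_mem_segment ℝ v w)

theorem sum_E_faceSum (hT : IsUnimodularTriangulation T P) (hP : IsLatticePolygon P) (m : ℕ) :
    ∑ e ∈ (hT.finite_E hP).toFinset, faceSum (m + 1) e.toFinset =
      ((m - 1) * m * (m + 1) / 6 : ℝ) • ∑ e ∈ (hT.finite_E hP).toFinset, endSq e
      + (m * (m + 1) * (m + 2) / 6 : ℝ) • ∑ e ∈ (hT.finite_E hP).toFinset, sumSq e := by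
  rw [Finset.smul_sum, Finset.smul_sum, ← Finset.sum_add_distrib]
  refine Finset.sum_congr rfl fun e he => ?_
  rw [Set.Finite.mem_toFinset] at he
  induction e with
  | _ y z =>
    obtain ⟨w, hw, ho⟩ := hT.exists_unimodular_apex hP (mem_E.1 he).1 (mem_E.1 he).2
    rw [Sym2.toFinset_mk_eq, faceSum_pair (hT.mem_lattice hw (by simp))
      (hT.mem_lattice hw (by simp)) (hT.mem_lattice hw (by simp)) ho]

theorem sum_triangles_faceSum (hT : IsUnimodularTriangulation T P) (hP : IsLatticePolygon P)
    (m : ℕ) :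
    ∑ t ∈ triangles (hT.finite_faces hP), faceSum (m + 1) t =
      (-((m - 1) * m * (m + 1) / 12) : ℝ) • (∑ e ∈ (hT.finite_bdE hP).toFinset, endSq e
        + 2 • ∑ e ∈ (hT.finite_intE hP).toFinset, endSq e)
      + ((m - 1) * m * (m + 1) * (m + 2) / 24 : ℝ) •
        (∑ e ∈ (hT.finite_bdE hP).toFinset, sumSq e
        + 2 • ∑ e ∈ (hT.finite_intE hP).toFinset, sumSq e) := by
  rw [← hT.sum_triangles_sum_edges hP, ← hT.sum_triangles_sum_edges hP, Finset.smul_sum,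
    Finset.smul_sum, ← Finset.sum_add_distrib]
  refine Finset.sum_congr rfl fun t ht => ?_
  obtain ⟨ht, h3⟩ := mem_triangles.1 ht
  obtain ⟨a, b, c, hab, hac, hbc, rfl⟩ := Finset.card_eq_three.1 h3
  rw [hT.sum_triangle_edges hP _ ht hab hac hbc, hT.sum_triangle_edges hP _ ht hab hac hbc,
    faceSum_triple (hT.mem_lattice ht (by simp)) (hT.mem_lattice ht (by simp))
      (hT.mem_lattice ht (by simp)) (hT.abs_orient ht (orient_ne_zero ht hab hac hbc))]

end IsUnimodularTriangulation

/-! ### The case `n = 0` and the final assembly. -/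

theorem momentMatrix_zero_smul (hP : P.Nonempty) : momentMatrix ((0 : ℝ) • P) = 0 := by
  rw [momentMatrix, Set.zero_smul_set hP]
  refine finsum_mem_eq_zero_of_forall_eq_zero fun x hx => ?_
  rw [Set.mem_zero.1 hx.1]
  simp [sq]

end LatticePolygon

theorem proposition4p4 (P : Set (Fin 2 → ℝ)) (hP : LatticePolygon.IsLatticePolygon P)
    (T : Geometry.SimplicialComplex ℝ (Fin 2 → ℝ))
    (hT : LatticePolygon.IsUnimodularTriangulation T P) (n : ℕ) :
    LatticePolygon.momentMatrix ((n : ℝ) • P) =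
      ((n : ℝ) / 12) • (∑ᶠ e ∈ LatticePolygon.bdE T P, LatticePolygon.diffSq e)
      + ((n : ℝ) ^ 2 / 24) •
        ((12 : ℝ) • (∑ᶠ x ∈ LatticePolygon.V P, LatticePolygon.sq x)
          + (12 : ℝ) • (∑ᶠ x ∈ LatticePolygon.intV P, LatticePolygon.sq x)
          - (∑ᶠ e ∈ LatticePolygon.E T, LatticePolygon.sumSq e)
          - (∑ᶠ e ∈ LatticePolygon.intE T P, LatticePolygon.sumSq e))
      + ((n : ℝ) ^ 3 / 12) •
        ((2 : ℝ) • (∑ᶠ x ∈ LatticePolygon.bdV P, LatticePolygon.sq x)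
          + (∑ᶠ e ∈ LatticePolygon.bdE T P, LatticePolygon.sumSq e))
      + ((n : ℝ) ^ 4 / 24) •
        ((∑ᶠ e ∈ LatticePolygon.E T, LatticePolygon.sumSq e)
          + (∑ᶠ e ∈ LatticePolygon.intE T P, LatticePolygon.sumSq e)) := by
  rcases n with _ | m
  -- The dilates by `0` of all faces collapse to the origin, so the face decomposition is not
  -- available here.
  · rw [Nat.cast_zero, LatticePolygon.momentMatrix_zero_smul (hP.2.mono interior_subset)]
    simp
  · rw [hT.momentMatrix_smul hP m.succ_ne_zero, hT.sum_faces hP, hT.sum_E_faceSum hP,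
      hT.sum_triangles_faceSum hP,
      finsum_mem_eq_finite_toFinset_sum _ (hT.finite_bdE hP),
      finsum_mem_eq_finite_toFinset_sum _ (hT.finite_bdE hP),
      finsum_mem_eq_finite_toFinset_sum _ (hT.finite_E hP),
      finsum_mem_eq_finite_toFinset_sum _ (hT.finite_intE hP),
      finsum_mem_eq_finite_toFinset_sum _ hP.finite_V,
      finsum_mem_eq_finite_toFinset_sum _ hP.finite_intV,
      finsum_mem_eq_finite_toFinset_sum _ hP.finite_bdV,
      Finset.sum_congr rfl fun v hv => LatticePolygon.faceSum_singleton
        ((Set.Finite.mem_toFinset _).1 hv).2 (m + 1), ← Finset.smul_sum,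
      Finset.sum_congr rfl fun e _ => LatticePolygon.diffSq_eq e, Finset.sum_sub_distrib,
      ← Finset.smul_sum]
    -- After splitting into boundary and interior parts, the interior `endSq` sum has coefficient
    -- `(m - 1)m(m + 1)(1/6 - 2/12) = 0`; what remains is polynomial arithmetic with `n = m + 1`.
    simp only [hT.sum_E hP, hP.sum_V, hT.sum_bdE_endSq hP]
    push_cast
    module
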